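/- Let $p,q\in(0,1)$ with $p^2+q^2=1$, and let $\mathrm{sn}_p,\mathrm{cn}_p,\mathrm{dn}_p:\mathbb C\to\mathbb C\cup\{\infty\}$ be the Jacobi elliptic functions with modulus $p$, that is, the meromorphic functions with $\mathrm{sn}_p'=\mathrm{cn}_p\,\mathrm{dn}_p$, $\mathrm{cn}_p'=-\mathrm{sn}_p\,\mathrm{dn}_p$, $\mathrm{dn}_p'=-p^2\,\mathrm{sn}_p\,\mathrm{cn}_p$ and $\mathrm{sn}_p(0)=0$, $\mathrm{cn}_p(0)=\mathrm{dn}_p(0)=1$; let $P$ be their common set of poles. Let $\Omega:=\{z\in\mathbb C:\mathrm{dn}_p(z)\neq 0\}$ (which contains $P$), and consider on $\Omega$ the multivalued map $$x^\ast(z)=\frac{2}{pq}\,\mathrm{Re}\begin{pmatrix} q\,\mathrm{artanh}\frac{1}{p\,\mathrm{sn}_p}\\ \arctan\frac{q}{p\,\mathrm{cn}_p}\\ p\,\mathrm{artanh}\left(\frac qi\,\frac{\mathrm{sn}_p}{\mathrm{cn}_p}\right)\end{pmatrix}(z),\qquad z=u+iv .$$ A branch of $x^\ast$ on an open set $U\subset\Omega$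 is a continuous map $U\to\mathbb R^3$ whose value at each point of $U\setminus P$ is one of the values of this expression (only the second component is multivalued, modulo $\frac{2\pi}{pq}$). Then: 1. $x^\ast$ has a branch on every simply connected open set $U\subset\Omega$. 2. Every branch of $x^\ast$ on an open set $U\subset\Omega$ is a smooth immersion, conformal, parametrized by curvature lines (the partial derivatives satisfy $x^\ast_u\perp x^\ast_v$ and $\det(x^\ast_{uv},x^\ast_u,x^\ast_v)=0$), and has vanishing mean curvature. It is obtained, up to the reflection $(x_1,x_2,x_3)\mapsto(x_1,x_2,-x_3)$, from the Weierstrass representation with $y=\mathrm{sn}_p-i\,\mathrm{cn}_p$ and the quadratic differential $dz^2$: on $U\setminus P$ the function $y$ is holomorphic with $y'\ne0$, and $$d\,(x^\ast_1,\,x^\ast_2,\,-x^\ast_3)=\mathrm{Re}\left\{\left(1-y^2,\; i(1+y^2),\; -2y\right)\frac{dz}{y'}\right\}.$$ 3. Every branch takes its values in Scherk's (singly periodic) saddle tower $$S=\left\{x\in\mathbb R^3:\; q^2\cosh(p\,x_1)+\cos(pq\,x_2)-p^2\cosh(q\,x_3)=0\right\},$$ and every point of $S$ is a value of some branch of $x^\ast$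 on some open subset of $\Omega$. Thus $x^\ast$ is a (conformal) curvature line parametrization of the Scherk saddle tower $S$. -/

import Mathlib

open scoped ContDiff

noncomputable section

/-! ### Jacobi elliptic functions with modulus `k ∈ (0, 1)` -/

/-- The incomplete elliptic integral of the first kind
`F(φ, k) = ∫₀^φ dθ / √(1 - k² sin² θ)`; for `0 < k < 1` it is a bijection of `ℝ`. -/
def ellipticF (k φ : ℝ) : ℝ :=
  ∫ θ in (0 : ℝ)..φ, 1 / Real.sqrt (1 - k ^ 2 * Real.sin θ ^ 2)

/-- The Jacobi amplitude function on the real line, i.e. the inverse of `φ ↦ F(φ, k)`. -/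
def realAm (k u : ℝ) : ℝ := Function.invFun (ellipticF k) u

/-- `sn u = sin (am u)` for real `u`. -/
def realSn (k u : ℝ) : ℝ := Real.sin (realAm k u)

/-- `cn u = cos (am u)` for real `u`. -/
def realCn (k u : ℝ) : ℝ := Real.cos (realAm k u)

/-- `dn u = √(1 - k² sn² u)` for real `u`. -/
def realDn (k u : ℝ) : ℝ := Real.sqrt (1 - k ^ 2 * realSn k u ^ 2)

/-- The complementary modulus `k' = √(1 - k²)`. -/
def compMod (k : ℝ) : ℝ := Real.sqrt (1 - k ^ 2)

/-- The common denominator `cn²(v, k') + k² sn²(u, k) sn²(v, k')` in the formulas that express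
the Jacobi functions at `z = u + i v` through real ones. -/
def jacobiDen (k : ℝ) (z : ℂ) : ℝ :=
  realCn (compMod k) z.im ^ 2 + k ^ 2 * realSn k z.re ^ 2 * realSn (compMod k) z.im ^ 2

/-- The set of (common) poles of the Jacobi functions `sn`, `cn`, `dn` in `ℂ`. -/
def jacobiPoles (k : ℝ) : Set ℂ := {z | jacobiDen k z = 0}

/-- Jacobi's `sn` on `ℂ`, by the standard formula for its real and imaginary parts (addition
theorem combined with Jacobi's imaginary transformation); the value at a pole is irrelevant. -/
def jacobiSn (k : ℝ) (z : ℂ) : ℂ :=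
  ((realSn k z.re * realDn (compMod k) z.im : ℝ) +
    Complex.I * (realCn k z.re * realDn k z.re * realSn (compMod k) z.im *
      realCn (compMod k) z.im : ℝ)) / (jacobiDen k z : ℝ)

/-- Jacobi's `cn` on `ℂ`; see `jacobiSn`. -/
def jacobiCn (k : ℝ) (z : ℂ) : ℂ :=
  ((realCn k z.re * realCn (compMod k) z.im : ℝ) -
    Complex.I * (realSn k z.re * realDn k z.re * realSn (compMod k) z.im *
      realDn (compMod k) z.im : ℝ)) / (jacobiDen k z : ℝ)

/-- Jacobi's `dn` on `ℂ`; see `jacobiSn`. -/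
def jacobiDn (k : ℝ) (z : ℂ) : ℂ :=
  ((realDn k z.re * realCn (compMod k) z.im * realDn (compMod k) z.im : ℝ) -
    Complex.I * (k ^ 2 * realSn k z.re * realCn k z.re * realSn (compMod k) z.im : ℝ)) /
      (jacobiDen k z : ℝ)

/-- `sn`, `cn`, `dn` are the Jacobi elliptic functions with modulus `k` and pole set `P`: the
meromorphic functions on `ℂ` that solve the Jacobi differential equations off their set `P` of
poles, with the values `0, 1, 1` at the origin. -/
structure IsJacobiTriple (k : ℝ) (P : Set ℂ) (sn cn dn : ℂ → ℂ) : Prop where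
  meromorphic : ∀ z, MeromorphicAt sn z ∧ MeromorphicAt cn z ∧ MeromorphicAt dn z
  pole : ∀ z ∈ P, Filter.Tendsto sn (nhdsWithin z {z}ᶜ) (Bornology.cobounded ℂ) ∧
    Filter.Tendsto cn (nhdsWithin z {z}ᶜ) (Bornology.cobounded ℂ) ∧
    Filter.Tendsto dn (nhdsWithin z {z}ᶜ) (Bornology.cobounded ℂ)
  zero_notMem : (0 : ℂ) ∉ P
  sn_zero : sn 0 = 0
  cn_zero : cn 0 = 1
  dn_zero : dn 0 = 1
  deriv_sn : ∀ z ∉ P, HasDerivAt sn (cn z * dn z) z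
  deriv_cn : ∀ z ∉ P, HasDerivAt cn (-(sn z * dn z)) z
  deriv_dn : ∀ z ∉ P, HasDerivAt dn (-((k : ℂ) ^ 2 * sn z * cn z)) z

/-! ### Values of the multivalued functions `artanh` and `arctan` on `ℂ ∪ {∞}` -/

/-- For `(a, b) ≠ (0, 0)`: `w` is a value of `artanh (a / b)`, i.e. `tanh w = a / b` in
`ℂ ∪ {∞}`. -/
def IsArtanhQuot (w a b : ℂ) : Prop := a * Complex.cosh w = b * Complex.sinh w

/-- For `(a, b) ≠ (0, 0)`: `w` is a value of `arctan (a / b)`, i.e. `tan w = a / b` in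
`ℂ ∪ {∞}`. -/
def IsArctanQuot (w a b : ℂ) : Prop := a * Complex.cos w = b * Complex.sin w

/-! ### Surfaces in Euclidean space, parametrized by `z = u + i v` -/

/-- Euclidean `3`-space. -/
abbrev E3 : Type := EuclideanSpace ℝ (Fin 3)

/-- The partial derivative `X_u`. -/
def dU (X : ℂ → E3) (z : ℂ) : E3 := fderiv ℝ X z 1

/-- The partial derivative `X_v`. -/
def dV (X : ℂ → E3) (z : ℂ) : E3 := fderiv ℝ X z Complex.I

/-- The determinant of three vectors in `ℝ³`. -/
def det3 (a b c : E3) : ℝ := Matrix.det (Matrix.of ![a.ofLp, b.ofLp, c.ofLp])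

/-- `X` is a regular smooth surface on the open set `U`. -/
structure IsRegularSurface (U : Set ℂ) (X : ℂ → E3) : Prop where
  smooth : ContDiffOn ℝ ∞ X U
  immersion : ∀ z ∈ U, LinearIndependent ℝ ![dU X z, dV X z]

/-- The coordinates `(u, v)` are curvature line parameters of the surface `X`: they are
orthogonal and conjugate, that is, both fundamental forms are diagonal. -/
structure IsCurvatureLineParam (U : Set ℂ) (X : ℂ → E3) : Prop where
  regular : IsRegularSurface U X
  orthogonal : ∀ z ∈ U, inner ℝ (dU X z) (dV X z) = 0
  conjugate : ∀ z ∈ U, det3 (dV (dU X) z) (dU X z) (dV X z) = 0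

/-- The parametrization is conformal: `|X_u| = |X_v|` and `X_u ⊥ X_v`. -/
def IsConformalParam (U : Set ℂ) (X : ℂ → E3) : Prop :=
  ∀ z ∈ U, ‖dU X z‖ = ‖dV X z‖ ∧ inner ℝ (dU X z) (dV X z) = 0

/-- The mean curvature vanishes: `E N - 2 F M + G L = 0`, where the coefficients `L, M, N` of the
second fundamental form are multiplied by the common factor `|X_u × X_v|`. -/
def IsMinimalSurface (U : Set ℂ) (X : ℂ → E3) : Prop :=
  ∀ z ∈ U,
    inner ℝ (dU X z) (dU X z) * det3 (dV (dV X) z) (dU X z) (dV X z)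
      - 2 * inner ℝ (dU X z) (dV X z) * det3 (dV (dU X) z) (dU X z) (dV X z)
      + inner ℝ (dV X z) (dV X z) * det3 (dU (dU X) z) (dU X z) (dV X z) = 0

/-- The coefficient of `dz` in the Weierstrass data
`(1 - y², i (1 + y²), -2 y) 𝔮 / dy`, where `𝔮 = Q dz²` and `dy = y' dz`. -/
def weierstrassForm (y Q : ℂ → ℂ) (z : ℂ) : Fin 3 → ℂ :=
  ![(1 - y z ^ 2) * (Q z / deriv y z),
    Complex.I * (1 + y z ^ 2) * (Q z / deriv y z),
    -2 * y z * (Q z / deriv y z)]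

/-- `X = Re ∫ (1 - y², i (1 + y²), -2 y) 𝔮 / dy` on `U`, for a holomorphic function `y` without
critical points and `𝔮 = Q dz²`: the differential of `X` is the real part of the Weierstrass
one-form. -/
structure IsWeierstrassRep (y Q : ℂ → ℂ) (U : Set ℂ) (X : ℂ → E3) : Prop where
  holo : ∀ z ∈ U, DifferentiableAt ℂ y z ∧ deriv y z ≠ 0
  diff : ∀ z ∈ U, ∀ j : Fin 3, HasFDerivAt (fun w => X w j)
    (Complex.reCLM.comp (ContinuousLinearMap.mul ℝ ℂ (weierstrassForm y Q z j))) z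

/-- The reflection `(x₁, x₂, x₃) ↦ (x₁, x₂, -x₃)`. -/
def reflect3 (x : E3) : E3 := !₂[x 0, x 1, -x 2]

/-! ### Scherk's saddle tower -/

/-- Scherk's (singly periodic) saddle tower, as the level surface
`q² cosh (p x₁) + cos (p q x₂) - p² cosh (q x₃) = 0`. With `p = sin φ`, `q = cos φ` and
`ξ = p q x`, shifted by half a period in the second coordinate, this is the classical
`cos² φ cosh (ξ₁ / cos φ) - sin² φ cosh (ξ₃ / sin φ) = cos ξ₂`. -/
def scherkTower (p q : ℝ) : Set E3 :=
  {x | q ^ 2 * Real.cosh (p * x 0) + Real.cos (p * q * x 1) - p ^ 2 * Real.cosh (q * x 2) = 0}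

/-- The domain of the parametrization: the plane without the zeros of `dn`, which correspond to the
ends of the tower. The poles of the Jacobi functions belong to the domain. -/
def scherkDomain (p : ℝ) : Set ℂ := {z | z ∈ jacobiPoles p ∨ jacobiDn p z ≠ 0}

/-- `X` is a branch on `U` of the multivalued map
`z ↦ (2 / (p q)) Re (q artanh (1 / (p sn)), arctan (q / (p cn)), p artanh ((q / i) (sn / cn)))`:
it is continuous, and off the poles of the Jacobi functions it takes values of this expression. -/
structure IsScherkBranch (p q : ℝ) (U : Set ℂ) (X : ℂ → E3) : Prop where
  continuousOn : ContinuousOn X U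
  value : ∀ z ∈ U, z ∉ jacobiPoles p → ∃ w₁ w₂ w₃ : ℂ,
    IsArtanhQuot w₁ 1 (p * jacobiSn p z) ∧
    IsArctanQuot w₂ q (p * jacobiCn p z) ∧
    IsArtanhQuot w₃ ((q / Complex.I) * jacobiSn p z) (jacobiCn p z) ∧
    X z = (2 / (p * q)) • !₂[q * w₁.re, w₂.re, p * w₃.re]

end

noncomputable section

/-! ### The real Jacobi functions -/

/-! Dividing by `dn` removes the poles. The quotients C = cn/dn, S = sn/dn and N = 1/dn are
holomorphic on the whole domain Ω, with N = 0 exactly at the poles of the Jacobi functions. They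
satisfy C² = 1 - q²S², N² = 1 + p²S² and C' = -q²SN, S' = CN, N' = p²SC. All of this reduces to
polynomial identities in six real functions, because every function involved is given by its real
and imaginary parts over a real denominator.

The relations factor as (N + pS)(N - pS) = 1, (pC + iqN)(pC - iqN) = 1 and (C - iqS)(C + iqS) = 1.
The first factors E₁, E₂, E₃ are therefore nowhere zero on Ω, and the exponentials of the
multivalued expression are -E₁², E₂², E₃². Hence exp(p x₁) = |E₁|², exp(q x₃) = |E₃|², and p q x₂ is
twice an argument of E₂ (`isScherkValue_iff`). This description also makes sense at the poles, and
continuity carries it there (`isScherkBranch_iff`). Branches on simply connected sets come from a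
logarithm of E₂.

The logarithmic derivatives of E₁, E₂, E₃ are pC, ipqS, -iqN, so dx = Re(φ dz) with φ = 2(C, S,
-iN). The differential geometry follows from φ·φ = 0, φ ≠ 0 and φ × φ' = 2iφ. The equation of the
tower follows by expressing the two hyperbolic cosines and the cosine through |C|², |S|², |N|²
(`IsScherkValue.mem_scherkTower`).

Conversely, a point of the tower gives explicit numbers C, S, N on the curve above, and
`exists_jacobi_eq` finds z with these values. There S takes every complex value because its image is
open (open mapping theorem) and closed (periodicity, and no finite limit of S is possible at zeros
of `dn`); two symmetries then correct the signs of C and N. -/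

lemma one_sub_sq_mul_sin_sq_pos {k : ℝ} (hk : k ∈ Set.Ioo (0 : ℝ) 1) (φ : ℝ) :
    0 < 1 - k ^ 2 * Real.sin φ ^ 2 := by
  have h1 : k ^ 2 < 1 := by nlinarith [hk.1, hk.2]
  nlinarith [Real.sin_sq_le_one φ, sq_nonneg (Real.sin φ), sq_nonneg k]

lemma hasDerivAt_ellipticF {k : ℝ} (hk : k ∈ Set.Ioo (0 : ℝ) 1) (φ : ℝ) :
    HasDerivAt (ellipticF k) (1 / Real.sqrt (1 - k ^ 2 * Real.sin φ ^ 2)) φ := by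
  have hc : Continuous fun θ : ℝ => 1 / Real.sqrt (1 - k ^ 2 * Real.sin θ ^ 2) := by
    refine Continuous.div continuous_const (by fun_prop) fun θ => ?_
    exact (Real.sqrt_pos.2 (one_sub_sq_mul_sin_sq_pos hk θ)).ne'
  exact intervalIntegral.integral_hasDerivAt_right (hc.intervalIntegrable _ _)
    (hc.stronglyMeasurableAtFilter _ _) hc.continuousAt

lemma ellipticF_zero (k : ℝ) : ellipticF k 0 = 0 := by simp [ellipticF]

lemma ellipticF_strictMono {k : ℝ} (hk : k ∈ Set.Ioo (0 : ℝ) 1) : StrictMono (ellipticF k) :=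
  strictMono_of_hasDerivAt_pos (fun φ => hasDerivAt_ellipticF hk φ) fun φ =>
    one_div_pos.2 (Real.sqrt_pos.2 (one_sub_sq_mul_sin_sq_pos hk φ))

lemma ellipticF_continuous {k : ℝ} (hk : k ∈ Set.Ioo (0 : ℝ) 1) : Continuous (ellipticF k) :=
  continuous_iff_continuousAt.2 fun φ => (hasDerivAt_ellipticF hk φ).continuousAt

/-- The integrand is at least 1. This comparison with the identity drives `ellipticF` to ±∞ and so
makes it surjective. -/
lemma ellipticF_sub_id_monotone {k : ℝ} (hk : k ∈ Set.Ioo (0 : ℝ) 1) :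
    Monotone fun φ => ellipticF k φ - φ := by
  refine monotone_of_hasDerivAt_nonneg
    (fun φ => (hasDerivAt_ellipticF hk φ).sub (hasDerivAt_id φ)) fun φ => ?_
  have h := one_sub_sq_mul_sin_sq_pos hk φ
  have h1 : Real.sqrt (1 - k ^ 2 * Real.sin φ ^ 2) ≤ 1 := by
    rw [Real.sqrt_le_one]
    nlinarith [sq_nonneg (k * Real.sin φ)]
  have := one_le_one_div (Real.sqrt_pos.2 h) h1
  simpa using this

lemma ellipticF_surjective {k : ℝ} (hk : k ∈ Set.Ioo (0 : ℝ) 1) :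
    Function.Surjective (ellipticF k) := by
  have hm := ellipticF_sub_id_monotone hk
  refine (ellipticF_continuous hk).surjective ?_ ?_
  · refine Filter.tendsto_atTop_mono' _ ?_ Filter.tendsto_id
    filter_upwards [Filter.eventually_ge_atTop 0] with φ hφ
    have := hm hφ
    simp only [ellipticF_zero] at this
    simp only [id]; linarith
  · refine Filter.tendsto_atBot_mono' _ ?_ Filter.tendsto_id
    filter_upwards [Filter.eventually_le_atBot 0] with φ hφ
    have := hm hφ
    simp only [ellipticF_zero] at this
    simp only [id]; linarith

lemma realAm_ellipticF {k : ℝ} (hk : k ∈ Set.Ioo (0 : ℝ) 1) (φ : ℝ) :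
    realAm k (ellipticF k φ) = φ :=
  Function.leftInverse_invFun (ellipticF_strictMono hk).injective φ

lemma ellipticF_realAm {k : ℝ} (hk : k ∈ Set.Ioo (0 : ℝ) 1) (u : ℝ) :
    ellipticF k (realAm k u) = u :=
  Function.rightInverse_invFun (ellipticF_surjective hk) u

lemma realAm_zero {k : ℝ} (hk : k ∈ Set.Ioo (0 : ℝ) 1) : realAm k 0 = 0 := by
  simpa [ellipticF_zero] using realAm_ellipticF hk 0

lemma realAm_continuous {k : ℝ} (hk : k ∈ Set.Ioo (0 : ℝ) 1) : Continuous (realAm k) := by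
  -- A monotone surjection of ℝ has no jumps.
  refine Monotone.continuous_of_surjective (fun a b hab => ?_) fun φ => ⟨_, realAm_ellipticF hk φ⟩
  rw [← (ellipticF_strictMono hk).le_iff_le, ellipticF_realAm hk, ellipticF_realAm hk]
  exact hab

lemma hasDerivAt_realAm {k : ℝ} (hk : k ∈ Set.Ioo (0 : ℝ) 1) (u : ℝ) :
    HasDerivAt (realAm k) (realDn k u) u := by
  have hpos := Real.sqrt_pos.2 (one_sub_sq_mul_sin_sq_pos hk (realAm k u))
  have := HasDerivAt.of_local_left_inverse (realAm_continuous hk).continuousAt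
    (hasDerivAt_ellipticF hk (realAm k u)) (one_div_pos.2 hpos).ne'
    (Filter.Eventually.of_forall (ellipticF_realAm hk))
  simpa [realDn, realSn] using this

lemma realSn_sq_add_realCn_sq (k u : ℝ) : realSn k u ^ 2 + realCn k u ^ 2 = 1 :=
  Real.sin_sq_add_cos_sq _

lemma realDn_sq {k : ℝ} (hk : k ∈ Set.Ioo (0 : ℝ) 1) (u : ℝ) :
    realDn k u ^ 2 = 1 - k ^ 2 * realSn k u ^ 2 :=
  Real.sq_sqrt (one_sub_sq_mul_sin_sq_pos hk _).le

lemma realDn_pos {k : ℝ} (hk : k ∈ Set.Ioo (0 : ℝ) 1) (u : ℝ) : 0 < realDn k u :=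
  Real.sqrt_pos.2 (one_sub_sq_mul_sin_sq_pos hk _)

lemma hasDerivAt_realSn {k : ℝ} (hk : k ∈ Set.Ioo (0 : ℝ) 1) (u : ℝ) :
    HasDerivAt (realSn k) (realCn k u * realDn k u) u :=
  (hasDerivAt_realAm hk u).sin

lemma hasDerivAt_realCn {k : ℝ} (hk : k ∈ Set.Ioo (0 : ℝ) 1) (u : ℝ) :
    HasDerivAt (realCn k) (-(realSn k u * realDn k u)) u := by
  simpa using! (hasDerivAt_realAm hk u).cos

lemma hasDerivAt_realDn {k : ℝ} (hk : k ∈ Set.Ioo (0 : ℝ) 1) (u : ℝ) :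
    HasDerivAt (realDn k) (-(k ^ 2 * realSn k u * realCn k u)) u := by
  have h := ((((hasDerivAt_realSn hk u).pow 2).const_mul (k ^ 2)).const_sub 1).sqrt
    (one_sub_sq_mul_sin_sq_pos hk _).ne'
  refine h.congr_deriv ?_
  have hd := (realDn_pos hk u).ne'
  change _ / (2 * realDn k u) = _
  field_simp
  simp
  ring

lemma realSn_zero {k : ℝ} (hk : k ∈ Set.Ioo (0 : ℝ) 1) : realSn k 0 = 0 := by
  simp [realSn, realAm_zero hk]

lemma realCn_zero {k : ℝ} (hk : k ∈ Set.Ioo (0 : ℝ) 1) : realCn k 0 = 1 := by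
  simp [realCn, realAm_zero hk]

/-- Every amplitude modulo `2π` is attained on a fixed compact interval. -/
lemma exists_mem_Icc_realAm_trig_eq {k : ℝ} (hk : k ∈ Set.Ioo (0 : ℝ) 1) (θ : ℝ) :
    ∃ u ∈ Set.Icc 0 (ellipticF k (2 * Real.pi)),
      realSn k u = Real.sin θ ∧ realCn k u = Real.cos θ := by
  obtain ⟨t, ht, n, hn⟩ : ∃ t ∈ Set.Icc 0 (2 * Real.pi), ∃ n : ℤ, t = θ + n * (2 * Real.pi) := by
    refine ⟨toIcoMod Real.two_pi_pos 0 θ, ?_, -toIcoDiv Real.two_pi_pos 0 θ, ?_⟩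
    · have := toIcoMod_mem_Ico Real.two_pi_pos 0 θ
      exact ⟨this.1, by linarith [this.2]⟩
    · have := toIcoMod_add_toIcoDiv_zsmul Real.two_pi_pos 0 θ
      simp only [zsmul_eq_mul] at this
      push_cast; linarith
  refine ⟨ellipticF k t, ⟨?_, (ellipticF_strictMono hk).monotone ht.2⟩, ?_, ?_⟩
  · simpa [ellipticF_zero] using (ellipticF_strictMono hk).monotone ht.1
  · rw [realSn, realAm_ellipticF hk, hn, Real.sin_add_int_mul_two_pi]
  · rw [realCn, realAm_ellipticF hk, hn, Real.cos_add_int_mul_two_pi]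

lemma compMod_eq {p q : ℝ} (hq : q ∈ Set.Ioo (0 : ℝ) 1) (hpq : p ^ 2 + q ^ 2 = 1) :
    compMod p = q := by
  rw [compMod, show 1 - p ^ 2 = q ^ 2 by linarith, Real.sqrt_sq hq.1.le]

/-! ### Complex differentiability from partial derivatives -/

/-- The real function `f` on `ℂ` is differentiable at `z` with partial derivatives `a`, `b`. -/
def HasPartials (f : ℂ → ℝ) (a b : ℝ) (z : ℂ) : Prop :=
  HasFDerivAt f (a • Complex.reCLM + b • Complex.imCLM) z

namespace HasPartials

variable {f g : ℂ → ℝ} {a b a' b' : ℝ} {z : ℂ}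

lemma mul (hf : HasPartials f a b z) (hg : HasPartials g a' b' z) :
    HasPartials (fun w => f w * g w) (a * g z + f z * a') (b * g z + f z * b') z := by
  refine (HasFDerivAt.mul hf hg).congr_fderiv ?_
  ext
  simp
  ring

lemma add (hf : HasPartials f a b z) (hg : HasPartials g a' b' z) :
    HasPartials (fun w => f w + g w) (a + a') (b + b') z := by
  refine (HasFDerivAt.add hf hg).congr_fderiv ?_
  ext
  simp
  ring

lemma neg (hf : HasPartials f a b z) : HasPartials (fun w => -f w) (-a) (-b) z := by
  refine (HasFDerivAt.neg hf).congr_fderiv ?_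
  ext
  simp
  ring

lemma const (r : ℝ) : HasPartials (fun _ => r) 0 0 z := by
  simpa [HasPartials] using hasFDerivAt_const r z

lemma div (hf : HasPartials f a b z) (hg : HasPartials g a' b' z) (h : g z ≠ 0) :
    HasPartials (fun w => f w / g w) ((a * g z - f z * a') / g z ^ 2)
      ((b * g z - f z * b') / g z ^ 2) z := by
  have h1 : HasPartials (fun w => (g w)⁻¹) (-a' / g z ^ 2) (-b' / g z ^ 2) z := by
    refine ((hasDerivAt_inv h).comp_hasFDerivAt z hg).congr_fderiv ?_
    ext
    simp
    field_simp
  have := hf.mul h1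
  simp only [← div_eq_mul_inv] at this
  convert! this using 1 <;> field_simp <;> ring

lemma of_re {f : ℝ → ℝ} (hf : HasDerivAt f a z.re) : HasPartials (fun w => f w.re) a 0 z := by
  refine (hf.comp_hasFDerivAt z Complex.reCLM.hasFDerivAt).congr_fderiv ?_
  ext
  simp

lemma of_im {f : ℝ → ℝ} (hf : HasDerivAt f a z.im) : HasPartials (fun w => f w.im) 0 a z := by
  refine (hf.comp_hasFDerivAt z Complex.imCLM.hasFDerivAt).congr_fderiv ?_
  ext
  simp

/-- The Cauchy-Riemann criterion. -/
lemma hasDerivAt (hf : HasPartials f a b z) (hg : HasPartials g (-b) a z) :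
    HasDerivAt (fun w => (f w : ℂ) + Complex.I * (g w : ℂ)) (a - Complex.I * b) z := by
  have h1 := Complex.ofRealCLM.hasFDerivAt.comp z hf
  have h2 := (Complex.ofRealCLM.hasFDerivAt.comp z hg).const_mul Complex.I
  rw [hasDerivAt_iff_hasFDerivAt]
  refine hasFDerivAt_of_restrictScalars ℝ (h1.add h2) ?_
  ext w
  simp
  linear_combination -(a - Complex.I * b) * Complex.re_add_im w - b * w.im * Complex.I_sq

/-- The Cauchy-Riemann criterion for a quotient with real denominator, whose derivative is a
product of two such quotients. -/
lemma hasDerivAt_quot {F : ℂ → ℂ} {A B D : ℂ → ℝ} {Au Av Bu Bv Du Dv : ℝ}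
    (hF : ∀ w, F w = ((A w : ℂ) + Complex.I * (B w : ℂ)) / (D w : ℂ))
    (hA : HasPartials A Au Av z) (hB : HasPartials B Bu Bv z) (hD : HasPartials D Du Dv z)
    (h : D z ≠ 0) (r A₁ B₁ A₂ B₂ : ℝ)
    (hX : Au * D z - A z * Du = r * (A₁ * A₂ - B₁ * B₂))
    (hX' : Bv * D z - B z * Dv = r * (A₁ * A₂ - B₁ * B₂))
    (hY : Bu * D z - B z * Du = r * (A₁ * B₂ + B₁ * A₂))
    (hY' : Av * D z - A z * Dv = -(r * (A₁ * B₂ + B₁ * A₂))) :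
    HasDerivAt F (r * (((A₁ : ℂ) + Complex.I * B₁) / (D z : ℂ)) *
      (((A₂ : ℂ) + Complex.I * B₂) / (D z : ℂ))) z := by
  have h1 := hA.div hD h
  have h2 := hB.div hD h
  rw [hX, hY'] at h1
  rw [hY, hX'] at h2
  rw [← neg_neg (r * (A₁ * B₂ + B₁ * A₂)), neg_div] at h2
  have h3 := h1.hasDerivAt h2
  convert! h3 using 1
  · ext w; rw [hF]; push_cast; ring
  · push_cast
    linear_combination r * B₁ * B₂ / (D z : ℂ) ^ 2 * Complex.I_sq

end HasPartials

/-! ### The quotients `cd`, `sd`, `nd` -/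

/-- `|dn z|²` multiplied by `jacobiDen k z`. -/
def jacobiDen' (k : ℝ) (z : ℂ) : ℝ :=
  realDn (compMod k) z.im ^ 2 - k ^ 2 * realSn k z.re ^ 2

/-- `cd = cn / dn`, extended to the poles. -/
def jacobiCd (k : ℝ) (z : ℂ) : ℂ :=
  ((realCn k z.re * realDn k z.re * realDn (compMod k) z.im : ℝ) +
    Complex.I * (-(compMod k ^ 2 * realSn k z.re * realSn (compMod k) z.im *
      realCn (compMod k) z.im) : ℝ)) / (jacobiDen' k z : ℝ)

/-- `sd = sn / dn`, extended to the poles. -/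
def jacobiSd (k : ℝ) (z : ℂ) : ℂ :=
  ((realSn k z.re * realDn k z.re * realCn (compMod k) z.im : ℝ) +
    Complex.I * (realCn k z.re * realSn (compMod k) z.im * realDn (compMod k) z.im : ℝ)) /
      (jacobiDen' k z : ℝ)

/-- `nd = 1 / dn`, extended to the poles. -/
def jacobiNd (k : ℝ) (z : ℂ) : ℂ :=
  ((realDn k z.re * realCn (compMod k) z.im * realDn (compMod k) z.im : ℝ) +
    Complex.I * (k ^ 2 * realSn k z.re * realCn k z.re * realSn (compMod k) z.im : ℝ)) /
      (jacobiDen' k z : ℝ)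

/-- A point of `(0, 1)²` on the unit circle: a modulus with its complementary modulus. -/
structure IsModulusPair (p q : ℝ) : Prop where
  left : p ∈ Set.Ioo (0 : ℝ) 1
  right : q ∈ Set.Ioo (0 : ℝ) 1
  sq_add_sq : p ^ 2 + q ^ 2 = 1

namespace IsModulusPair

variable {p q : ℝ} (h : IsModulusPair p q)
include h

lemma compMod_eq : compMod p = q := _root_.compMod_eq h.right h.sq_add_sq


/-! ### Complex derivatives of sn, cn, dn and of cd, sd, nd. -/

lemma hasPartials_jacobiDen (z : ℂ) : HasPartials (jacobiDen p)
    (2 * p ^ 2 * realSn p z.re * (realCn p z.re * realDn p z.re) * realSn q z.im ^ 2)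
    (-2 * realCn q z.im * (realSn q z.im * realDn q z.im) +
      2 * p ^ 2 * realSn p z.re ^ 2 * realSn q z.im * (realCn q z.im * realDn q z.im)) z := by
  have hs := HasPartials.of_re (z := z) (hasDerivAt_realSn h.left z.re)
  have hs₁ := HasPartials.of_im (z := z) (hasDerivAt_realSn h.right z.im)
  have hc₁ := HasPartials.of_im (z := z) (hasDerivAt_realCn h.right z.im)
  convert! (hc₁.mul hc₁).add ((HasPartials.const (p ^ 2)).mul ((hs.mul hs).mul (hs₁.mul hs₁)))
    using 1
  · funext w; simp only [jacobiDen, h.compMod_eq]; ring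
  · ring
  · ring

lemma hasPartials_jacobiDen' (z : ℂ) : HasPartials (jacobiDen' p)
    (-2 * p ^ 2 * realSn p z.re * (realCn p z.re * realDn p z.re))
    (-2 * q ^ 2 * realDn q z.im * (realSn q z.im * realCn q z.im)) z := by
  have hs := HasPartials.of_re (z := z) (hasDerivAt_realSn h.left z.re)
  have hd₁ := HasPartials.of_im (z := z) (hasDerivAt_realDn h.right z.im)
  convert! (hd₁.mul hd₁).add ((HasPartials.const (-p ^ 2)).mul (hs.mul hs)) using 1
  · funext w; simp only [jacobiDen', h.compMod_eq]; ring
  · ring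
  · ring

/-- The quotient rule and the Cauchy-Riemann equations leave four polynomial identities in the
values s, c, d, s₁, c₁, d₁ of the real functions. They hold modulo s² + c² = 1, d² = 1 - p²s², their
analogues for modulus q, and p² + q² = 1. The explicit arguments of `hasDerivAt_quot` are the
constant factor of the derivative and the numerators of its two other factors. The next five
derivatives are found in the same way. -/
lemma hasDerivAt_jacobiSn {z : ℂ} (hz : jacobiDen p z ≠ 0) :
    HasDerivAt (jacobiSn p) (jacobiCn p z * jacobiDn p z) z := by
  have hs := HasPartials.of_re (z := z) (hasDerivAt_realSn h.left z.re)
  have hc := HasPartials.of_re (z := z) (hasDerivAt_realCn h.left z.re)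
  have hd := HasPartials.of_re (z := z) (hasDerivAt_realDn h.left z.re)
  have hs₁ := HasPartials.of_im (z := z) (hasDerivAt_realSn h.right z.im)
  have hc₁ := HasPartials.of_im (z := z) (hasDerivAt_realCn h.right z.im)
  have hd₁ := HasPartials.of_im (z := z) (hasDerivAt_realDn h.right z.im)
  have key := HasPartials.hasDerivAt_quot (F := jacobiSn p)
    (by intro w; simp only [jacobiSn, h.compMod_eq]; )
    ((hs.mul hd₁))
    ((((hc.mul hd).mul hs₁).mul hc₁)) (h.hasPartials_jacobiDen z) hz (1)
    (realCn p z.re * realCn q z.im)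
    (-(realSn p z.re * realDn p z.re * realSn q z.im * realDn q z.im))
    (realDn p z.re * realCn q z.im * realDn q z.im)
    (-(p ^ 2 * realSn p z.re * realCn p z.re * realSn q z.im))
  simp only [jacobiDen, h.compMod_eq] at key
  simp only [jacobiCn, jacobiDn, jacobiDen, h.compMod_eq]
  have e₁ := realSn_sq_add_realCn_sq p z.re
  have e₂ := realSn_sq_add_realCn_sq q z.im
  have e₃ := realDn_sq h.left z.re
  have e₄ := realDn_sq h.right z.im
  have e₅ := h.sq_add_sq
  clear hs hc hd hs₁ hc₁ hd₁
  generalize realSn p z.re = s at *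
  generalize realCn p z.re = c at *
  generalize realDn p z.re = d at *
  generalize realSn q z.im = s₁ at *
  generalize realCn q z.im = c₁ at *
  generalize realDn q z.im = d₁ at *
  convert key (by grind) (by grind) (by grind) (by grind) using 1
  push_cast
  ring

lemma hasDerivAt_jacobiCn {z : ℂ} (hz : jacobiDen p z ≠ 0) :
    HasDerivAt (jacobiCn p) (-(jacobiSn p z * jacobiDn p z)) z := by
  have hs := HasPartials.of_re (z := z) (hasDerivAt_realSn h.left z.re)
  have hc := HasPartials.of_re (z := z) (hasDerivAt_realCn h.left z.re)
  have hd := HasPartials.of_re (z := z) (hasDerivAt_realDn h.left z.re)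
  have hs₁ := HasPartials.of_im (z := z) (hasDerivAt_realSn h.right z.im)
  have hc₁ := HasPartials.of_im (z := z) (hasDerivAt_realCn h.right z.im)
  have hd₁ := HasPartials.of_im (z := z) (hasDerivAt_realDn h.right z.im)
  have key := HasPartials.hasDerivAt_quot (F := jacobiCn p)
    (by intro w; simp only [jacobiCn, h.compMod_eq]; push_cast; ring)
    ((hc.mul hc₁))
    ((((hs.mul hd).mul hs₁).mul hd₁).neg) (h.hasPartials_jacobiDen z) hz (-1)
    (realSn p z.re * realDn q z.im)
    (realCn p z.re * realDn p z.re * realSn q z.im * realCn q z.im)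
    (realDn p z.re * realCn q z.im * realDn q z.im)
    (-(p ^ 2 * realSn p z.re * realCn p z.re * realSn q z.im))
  simp only [jacobiDen, h.compMod_eq] at key
  simp only [jacobiSn, jacobiDn, jacobiDen, h.compMod_eq]
  have e₁ := realSn_sq_add_realCn_sq p z.re
  have e₂ := realSn_sq_add_realCn_sq q z.im
  have e₃ := realDn_sq h.left z.re
  have e₄ := realDn_sq h.right z.im
  have e₅ := h.sq_add_sq
  clear hs hc hd hs₁ hc₁ hd₁
  generalize realSn p z.re = s at *
  generalize realCn p z.re = c at *
  generalize realDn p z.re = d at *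
  generalize realSn q z.im = s₁ at *
  generalize realCn q z.im = c₁ at *
  generalize realDn q z.im = d₁ at *
  convert key (by grind) (by grind) (by grind) (by grind) using 1
  push_cast
  ring

lemma hasDerivAt_jacobiDn {z : ℂ} (hz : jacobiDen p z ≠ 0) :
    HasDerivAt (jacobiDn p) (-((p : ℂ) ^ 2 * jacobiSn p z * jacobiCn p z)) z := by
  have hs := HasPartials.of_re (z := z) (hasDerivAt_realSn h.left z.re)
  have hc := HasPartials.of_re (z := z) (hasDerivAt_realCn h.left z.re)
  have hd := HasPartials.of_re (z := z) (hasDerivAt_realDn h.left z.re)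
  have hs₁ := HasPartials.of_im (z := z) (hasDerivAt_realSn h.right z.im)
  have hc₁ := HasPartials.of_im (z := z) (hasDerivAt_realCn h.right z.im)
  have hd₁ := HasPartials.of_im (z := z) (hasDerivAt_realDn h.right z.im)
  have key := HasPartials.hasDerivAt_quot (F := jacobiDn p)
    (by intro w; simp only [jacobiDn, h.compMod_eq]; push_cast; ring)
    (((hd.mul hc₁).mul hd₁))
    (((((HasPartials.const (p ^ 2)).mul hs).mul hc).mul hs₁).neg) (h.hasPartials_jacobiDen z) hz (-p ^ 2)
    (realSn p z.re * realDn q z.im)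
    (realCn p z.re * realDn p z.re * realSn q z.im * realCn q z.im)
    (realCn p z.re * realCn q z.im)
    (-(realSn p z.re * realDn p z.re * realSn q z.im * realDn q z.im))
  simp only [jacobiDen, h.compMod_eq] at key
  simp only [jacobiSn, jacobiCn, jacobiDen, h.compMod_eq]
  have e₁ := realSn_sq_add_realCn_sq p z.re
  have e₂ := realSn_sq_add_realCn_sq q z.im
  have e₃ := realDn_sq h.left z.re
  have e₄ := realDn_sq h.right z.im
  have e₅ := h.sq_add_sq
  clear hs hc hd hs₁ hc₁ hd₁
  generalize realSn p z.re = s at *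
  generalize realCn p z.re = c at *
  generalize realDn p z.re = d at *
  generalize realSn q z.im = s₁ at *
  generalize realCn q z.im = c₁ at *
  generalize realDn q z.im = d₁ at *
  convert key (by grind) (by grind) (by grind) (by grind) using 1
  push_cast
  ring

lemma hasDerivAt_jacobiCd {z : ℂ} (hz : jacobiDen' p z ≠ 0) :
    HasDerivAt (jacobiCd p) (-((q : ℂ) ^ 2 * jacobiSd p z * jacobiNd p z)) z := by
  have hs := HasPartials.of_re (z := z) (hasDerivAt_realSn h.left z.re)
  have hc := HasPartials.of_re (z := z) (hasDerivAt_realCn h.left z.re)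
  have hd := HasPartials.of_re (z := z) (hasDerivAt_realDn h.left z.re)
  have hs₁ := HasPartials.of_im (z := z) (hasDerivAt_realSn h.right z.im)
  have hc₁ := HasPartials.of_im (z := z) (hasDerivAt_realCn h.right z.im)
  have hd₁ := HasPartials.of_im (z := z) (hasDerivAt_realDn h.right z.im)
  have key := HasPartials.hasDerivAt_quot (F := jacobiCd p)
    (by intro w; simp only [jacobiCd, h.compMod_eq]; )
    (((hc.mul hd).mul hd₁))
    (((((HasPartials.const (q ^ 2)).mul hs).mul hs₁).mul hc₁).neg) (h.hasPartials_jacobiDen' z) hz (-q ^ 2)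
    (realSn p z.re * realDn p z.re * realCn q z.im)
    (realCn p z.re * realSn q z.im * realDn q z.im)
    (realDn p z.re * realCn q z.im * realDn q z.im)
    (p ^ 2 * realSn p z.re * realCn p z.re * realSn q z.im)
  simp only [jacobiDen', h.compMod_eq] at key
  simp only [jacobiSd, jacobiNd, jacobiDen', h.compMod_eq]
  have e₁ := realSn_sq_add_realCn_sq p z.re
  have e₂ := realSn_sq_add_realCn_sq q z.im
  have e₃ := realDn_sq h.left z.re
  have e₄ := realDn_sq h.right z.im
  have e₅ := h.sq_add_sq
  clear hs hc hd hs₁ hc₁ hd₁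
  generalize realSn p z.re = s at *
  generalize realCn p z.re = c at *
  generalize realDn p z.re = d at *
  generalize realSn q z.im = s₁ at *
  generalize realCn q z.im = c₁ at *
  generalize realDn q z.im = d₁ at *
  convert key (by grind) (by grind) (by grind) (by grind) using 1
  push_cast
  ring

lemma hasDerivAt_jacobiSd {z : ℂ} (hz : jacobiDen' p z ≠ 0) :
    HasDerivAt (jacobiSd p) (jacobiCd p z * jacobiNd p z) z := by
  have hs := HasPartials.of_re (z := z) (hasDerivAt_realSn h.left z.re)
  have hc := HasPartials.of_re (z := z) (hasDerivAt_realCn h.left z.re)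
  have hd := HasPartials.of_re (z := z) (hasDerivAt_realDn h.left z.re)
  have hs₁ := HasPartials.of_im (z := z) (hasDerivAt_realSn h.right z.im)
  have hc₁ := HasPartials.of_im (z := z) (hasDerivAt_realCn h.right z.im)
  have hd₁ := HasPartials.of_im (z := z) (hasDerivAt_realDn h.right z.im)
  have key := HasPartials.hasDerivAt_quot (F := jacobiSd p)
    (by intro w; simp only [jacobiSd, h.compMod_eq]; )
    (((hs.mul hd).mul hc₁))
    (((hc.mul hs₁).mul hd₁)) (h.hasPartials_jacobiDen' z) hz (1)
    (realCn p z.re * realDn p z.re * realDn q z.im)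
    (-(q ^ 2 * realSn p z.re * realSn q z.im * realCn q z.im))
    (realDn p z.re * realCn q z.im * realDn q z.im)
    (p ^ 2 * realSn p z.re * realCn p z.re * realSn q z.im)
  simp only [jacobiDen', h.compMod_eq] at key
  simp only [jacobiCd, jacobiNd, jacobiDen', h.compMod_eq]
  have e₁ := realSn_sq_add_realCn_sq p z.re
  have e₂ := realSn_sq_add_realCn_sq q z.im
  have e₃ := realDn_sq h.left z.re
  have e₄ := realDn_sq h.right z.im
  have e₅ := h.sq_add_sq
  clear hs hc hd hs₁ hc₁ hd₁
  generalize realSn p z.re = s at *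
  generalize realCn p z.re = c at *
  generalize realDn p z.re = d at *
  generalize realSn q z.im = s₁ at *
  generalize realCn q z.im = c₁ at *
  generalize realDn q z.im = d₁ at *
  convert key (by grind) (by grind) (by grind) (by grind) using 1
  push_cast
  ring

lemma hasDerivAt_jacobiNd {z : ℂ} (hz : jacobiDen' p z ≠ 0) :
    HasDerivAt (jacobiNd p) ((p : ℂ) ^ 2 * jacobiSd p z * jacobiCd p z) z := by
  have hs := HasPartials.of_re (z := z) (hasDerivAt_realSn h.left z.re)
  have hc := HasPartials.of_re (z := z) (hasDerivAt_realCn h.left z.re)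
  have hd := HasPartials.of_re (z := z) (hasDerivAt_realDn h.left z.re)
  have hs₁ := HasPartials.of_im (z := z) (hasDerivAt_realSn h.right z.im)
  have hc₁ := HasPartials.of_im (z := z) (hasDerivAt_realCn h.right z.im)
  have hd₁ := HasPartials.of_im (z := z) (hasDerivAt_realDn h.right z.im)
  have key := HasPartials.hasDerivAt_quot (F := jacobiNd p)
    (by intro w; simp only [jacobiNd, h.compMod_eq]; )
    (((hd.mul hc₁).mul hd₁))
    (((((HasPartials.const (p ^ 2)).mul hs).mul hc).mul hs₁)) (h.hasPartials_jacobiDen' z) hz (p ^ 2)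
    (realSn p z.re * realDn p z.re * realCn q z.im)
    (realCn p z.re * realSn q z.im * realDn q z.im)
    (realCn p z.re * realDn p z.re * realDn q z.im)
    (-(q ^ 2 * realSn p z.re * realSn q z.im * realCn q z.im))
  simp only [jacobiDen', h.compMod_eq] at key
  simp only [jacobiSd, jacobiCd, jacobiDen', h.compMod_eq]
  have e₁ := realSn_sq_add_realCn_sq p z.re
  have e₂ := realSn_sq_add_realCn_sq q z.im
  have e₃ := realDn_sq h.left z.re
  have e₄ := realDn_sq h.right z.im
  have e₅ := h.sq_add_sq
  clear hs hc hd hs₁ hc₁ hd₁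
  generalize realSn p z.re = s at *
  generalize realCn p z.re = c at *
  generalize realDn p z.re = d at *
  generalize realSn q z.im = s₁ at *
  generalize realCn q z.im = c₁ at *
  generalize realDn q z.im = d₁ at *
  convert key (by grind) (by grind) (by grind) (by grind) using 1
  push_cast
  ring

lemma continuous_jacobiDen : Continuous (jacobiDen p) :=
  continuous_iff_continuousAt.2 fun z => HasFDerivAt.continuousAt (h.hasPartials_jacobiDen z)

lemma continuous_jacobiDen' : Continuous (jacobiDen' p) :=
  continuous_iff_continuousAt.2 fun z => HasFDerivAt.continuousAt (h.hasPartials_jacobiDen' z)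

/-! ### Algebraic relations -/

/-- `jacobiDen` is the sum of squares c₁² + (p s s₁)². If it vanishes then c₁ = 0, hence s₁² = 1 and
s = 0, and the other denominator equals 1 - q² = p². -/
lemma jacobiDen'_ne_zero_of_jacobiDen_eq_zero {z : ℂ} (hz : jacobiDen p z = 0) :
    jacobiDen' p z ≠ 0 := by
  have hp := h.left.1
  simp only [jacobiDen, jacobiDen', h.compMod_eq] at *
  have e₁ := realSn_sq_add_realCn_sq p z.re
  have e₂ := realSn_sq_add_realCn_sq q z.im
  have e₃ := realDn_sq h.left z.re
  have e₄ := realDn_sq h.right z.im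
  have e₅ := h.sq_add_sq
  generalize realSn p z.re = s at *
  generalize realCn p z.re = c at *
  generalize realDn p z.re = d at *
  generalize realSn q z.im = s₁ at *
  generalize realCn q z.im = c₁ at *
  generalize realDn q z.im = d₁ at *
  have h1 : c₁ ^ 2 = 0 := by nlinarith [sq_nonneg c₁, sq_nonneg (p * s * s₁)]
  have h2 : s ^ 2 = 0 := by
    have : p ^ 2 * s ^ 2 = 0 := by grind
    simpa [hp.ne'] using this
  have h3 : d₁ ^ 2 - p ^ 2 * s ^ 2 = p ^ 2 := by grind
  rw [h3]
  positivity

lemma jacobiSn_eq {z : ℂ} (hz : jacobiDen p z ≠ 0) (hz' : jacobiDen' p z ≠ 0) :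
    jacobiSn p z = jacobiSd p z * jacobiDn p z := by
  simp only [jacobiSn, jacobiSd, jacobiDn, jacobiDen, jacobiDen', h.compMod_eq] at *
  have e₁ := realSn_sq_add_realCn_sq p z.re
  have e₂ := realSn_sq_add_realCn_sq q z.im
  have e₃ := realDn_sq h.left z.re
  have e₄ := realDn_sq h.right z.im
  have e₅ := h.sq_add_sq
  generalize realSn p z.re = s at *
  generalize realCn p z.re = c at *
  generalize realDn p z.re = d at *
  generalize realSn q z.im = s₁ at *
  generalize realCn q z.im = c₁ at *
  generalize realDn q z.im = d₁ at *
  rw [div_mul_div_comm, div_eq_div_iff (by exact_mod_cast hz)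
    (by norm_cast; exact mul_ne_zero hz' hz)]
  apply Complex.ext
  · simp [-Complex.ofReal_mul, -Complex.ofReal_pow, -Complex.ofReal_add, -Complex.ofReal_sub]
    grind
  · simp [-Complex.ofReal_mul, -Complex.ofReal_pow, -Complex.ofReal_add, -Complex.ofReal_sub]
    grind

lemma jacobiCn_eq {z : ℂ} (hz : jacobiDen p z ≠ 0) (hz' : jacobiDen' p z ≠ 0) :
    jacobiCn p z = jacobiCd p z * jacobiDn p z := by
  simp only [jacobiCn, jacobiCd, jacobiDn, jacobiDen, jacobiDen', h.compMod_eq] at *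
  have e₁ := realSn_sq_add_realCn_sq p z.re
  have e₂ := realSn_sq_add_realCn_sq q z.im
  have e₃ := realDn_sq h.left z.re
  have e₄ := realDn_sq h.right z.im
  have e₅ := h.sq_add_sq
  generalize realSn p z.re = s at *
  generalize realCn p z.re = c at *
  generalize realDn p z.re = d at *
  generalize realSn q z.im = s₁ at *
  generalize realCn q z.im = c₁ at *
  generalize realDn q z.im = d₁ at *
  rw [div_mul_div_comm, div_eq_div_iff (by exact_mod_cast hz)
    (by norm_cast; exact mul_ne_zero hz' hz)]
  apply Complex.ext
  · simp [-Complex.ofReal_mul, -Complex.ofReal_pow, -Complex.ofReal_add, -Complex.ofReal_sub]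
    grind
  · simp [-Complex.ofReal_mul, -Complex.ofReal_pow, -Complex.ofReal_add, -Complex.ofReal_sub]
    grind

lemma jacobiNd_mul_jacobiDn {z : ℂ} (hz : jacobiDen p z ≠ 0) (hz' : jacobiDen' p z ≠ 0) :
    jacobiNd p z * jacobiDn p z = 1 := by
  simp only [jacobiNd, jacobiDn, jacobiDen, jacobiDen', h.compMod_eq] at *
  have e₁ := realSn_sq_add_realCn_sq p z.re
  have e₂ := realSn_sq_add_realCn_sq q z.im
  have e₃ := realDn_sq h.left z.re
  have e₄ := realDn_sq h.right z.im
  have e₅ := h.sq_add_sq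
  generalize realSn p z.re = s at *
  generalize realCn p z.re = c at *
  generalize realDn p z.re = d at *
  generalize realSn q z.im = s₁ at *
  generalize realCn q z.im = c₁ at *
  generalize realDn q z.im = d₁ at *
  rw [div_mul_div_comm, div_eq_iff (by norm_cast; exact mul_ne_zero hz' hz)]
  apply Complex.ext
  · simp [-Complex.ofReal_mul, -Complex.ofReal_pow, -Complex.ofReal_add, -Complex.ofReal_sub]
    grind
  · simp [-Complex.ofReal_mul, -Complex.ofReal_pow, -Complex.ofReal_add, -Complex.ofReal_sub]
    grind

lemma jacobiCd_sq {z : ℂ} (hz : jacobiDen' p z ≠ 0) :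
    jacobiCd p z ^ 2 = 1 - (q : ℂ) ^ 2 * jacobiSd p z ^ 2 := by
  simp only [jacobiSd, jacobiCd, jacobiDen', h.compMod_eq] at *
  have e₁ := realSn_sq_add_realCn_sq p z.re
  have e₂ := realSn_sq_add_realCn_sq q z.im
  have e₃ := realDn_sq h.left z.re
  have e₄ := realDn_sq h.right z.im
  have e₅ := h.sq_add_sq
  generalize realSn p z.re = s at *
  generalize realCn p z.re = c at *
  generalize realDn p z.re = d at *
  generalize realSn q z.im = s₁ at *
  generalize realCn q z.im = c₁ at *
  generalize realDn q z.im = d₁ at *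
  have hz' : ((d₁ ^ 2 - p ^ 2 * s ^ 2 : ℝ) : ℂ) ≠ 0 := by exact_mod_cast hz
  rw [div_pow, div_pow, eq_sub_iff_add_eq, ← mul_div_assoc, ← add_div, div_eq_one_iff_eq
    (pow_ne_zero 2 hz')]
  simp only [pow_two]
  apply Complex.ext
  · simp [-Complex.ofReal_mul, -Complex.ofReal_pow, -Complex.ofReal_add, -Complex.ofReal_sub]
    grind
  · simp [-Complex.ofReal_mul, -Complex.ofReal_pow, -Complex.ofReal_add, -Complex.ofReal_sub]
    grind

lemma jacobiNd_sq {z : ℂ} (hz : jacobiDen' p z ≠ 0) :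
    jacobiNd p z ^ 2 = 1 + (p : ℂ) ^ 2 * jacobiSd p z ^ 2 := by
  simp only [jacobiSd, jacobiNd, jacobiDen', h.compMod_eq] at *
  have e₁ := realSn_sq_add_realCn_sq p z.re
  have e₂ := realSn_sq_add_realCn_sq q z.im
  have e₃ := realDn_sq h.left z.re
  have e₄ := realDn_sq h.right z.im
  have e₅ := h.sq_add_sq
  generalize realSn p z.re = s at *
  generalize realCn p z.re = c at *
  generalize realDn p z.re = d at *
  generalize realSn q z.im = s₁ at *
  generalize realCn q z.im = c₁ at *
  generalize realDn q z.im = d₁ at *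
  have hz' : ((d₁ ^ 2 - p ^ 2 * s ^ 2 : ℝ) : ℂ) ≠ 0 := by exact_mod_cast hz
  rw [div_pow, div_pow, ← sub_eq_iff_eq_add, ← mul_div_assoc, ← sub_div, div_eq_one_iff_eq
    (pow_ne_zero 2 hz')]
  simp only [pow_two]
  apply Complex.ext
  · simp [-Complex.ofReal_mul, -Complex.ofReal_pow, -Complex.ofReal_add, -Complex.ofReal_sub]
    grind
  · simp [-Complex.ofReal_mul, -Complex.ofReal_pow, -Complex.ofReal_add, -Complex.ofReal_sub]
    grind

lemma normSq_jacobiDn {z : ℂ} (hz : jacobiDen p z ≠ 0) :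
    Complex.normSq (jacobiDn p z) * jacobiDen p z = jacobiDen' p z := by
  simp only [jacobiDn, jacobiDen, jacobiDen', h.compMod_eq] at *
  have e₁ := realSn_sq_add_realCn_sq p z.re
  have e₂ := realSn_sq_add_realCn_sq q z.im
  have e₃ := realDn_sq h.left z.re
  have e₄ := realDn_sq h.right z.im
  have e₅ := h.sq_add_sq
  generalize realSn p z.re = s at *
  generalize realCn p z.re = c at *
  generalize realDn p z.re = d at *
  generalize realSn q z.im = s₁ at *
  generalize realCn q z.im = c₁ at *
  generalize realDn q z.im = d₁ at *
  rw [Complex.normSq_div, Complex.normSq_ofReal, Complex.normSq_apply,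
    div_mul_eq_mul_div, div_eq_iff (mul_ne_zero hz hz)]
  simp [-Complex.ofReal_mul, -Complex.ofReal_pow, -Complex.ofReal_add, -Complex.ofReal_sub]
  grind

/-- Off the poles the two denominators differ by the factor |dn|², and at a pole `jacobiDen'` is
nonzero. So one condition covers both cases in the definition of Ω, and it is the condition under
which cd, sd and nd are holomorphic. -/
lemma mem_scherkDomain {z : ℂ} : z ∈ scherkDomain p ↔ jacobiDen' p z ≠ 0 := by
  by_cases hz : jacobiDen p z = 0
  · exact iff_of_true (Or.inl hz) (h.jacobiDen'_ne_zero_of_jacobiDen_eq_zero hz)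
  · have := h.normSq_jacobiDn hz
    have h1 : z ∉ jacobiPoles p := hz
    simp only [scherkDomain, Set.mem_ofPred_eq, h1, false_or, ← this, ne_eq, mul_eq_zero, hz,
      or_false, Complex.normSq_eq_zero]

lemma isOpen_scherkDomain : IsOpen (scherkDomain p) := by
  have : scherkDomain p = {z | jacobiDen' p z ≠ 0} := by
    ext z; exact h.mem_scherkDomain
  rw [this]
  exact isOpen_ne_fun h.continuous_jacobiDen' continuous_const

lemma jacobiNd_eq_zero {z : ℂ} (hz : jacobiDen p z = 0) : jacobiNd p z = 0 := by
  simp only [jacobiNd, jacobiDen, h.compMod_eq] at *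
  have e₂ := realSn_sq_add_realCn_sq q z.im
  have h1 : realCn q z.im ^ 2 = 0 := by
    nlinarith [sq_nonneg (realCn q z.im), sq_nonneg (p * realSn p z.re * realSn q z.im)]
  have h1' : realCn q z.im = 0 := by simpa using h1
  have h2 : realSn p z.re = 0 := by
    have : p ^ 2 * realSn p z.re ^ 2 = 0 := by grind
    simpa [h.left.1.ne'] using this
  simp [h1', h2]

lemma ofReal_sq_add_sq : (p : ℂ) ^ 2 + (q : ℂ) ^ 2 = 1 := by exact_mod_cast h.sq_add_sq

lemma jacobiSd_ne_zero_of_jacobiDen_eq_zero {z : ℂ} (hz : jacobiDen p z = 0) :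
    jacobiSd p z ≠ 0 := by
  intro h0
  have := h.jacobiNd_sq (h.jacobiDen'_ne_zero_of_jacobiDen_eq_zero hz)
  simp [h0, h.jacobiNd_eq_zero hz] at this

lemma jacobiCd_ne_zero_of_jacobiDen_eq_zero {z : ℂ} (hz : jacobiDen p z = 0) :
    jacobiCd p z ≠ 0 := by
  intro h0
  have hz' := h.jacobiDen'_ne_zero_of_jacobiDen_eq_zero hz
  have h1 := h.jacobiNd_sq hz'
  have h2 := h.jacobiCd_sq hz'
  have h3 := h.jacobiSd_ne_zero_of_jacobiDen_eq_zero hz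
  rw [h0] at h2
  rw [h.jacobiNd_eq_zero hz] at h1
  -- With C = N = 0 the two relations read q²S² = 1 and p²S² = -1, and their sum is S² = 0.
  have : jacobiSd p z ^ 2 = 0 := by
    linear_combination h2 - h1 - jacobiSd p z ^ 2 * h.ofReal_sq_add_sq
  exact h3 (by simpa using this)

lemma jacobiDn_ne_zero {z : ℂ} (hz : jacobiDen p z ≠ 0) (hz' : jacobiDen' p z ≠ 0) :
    jacobiDn p z ≠ 0 :=
  right_ne_zero_of_mul_eq_one (h.jacobiNd_mul_jacobiDn hz hz')

/-! ### Behaviour at the poles -/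

lemma eventually_jacobiDen'_ne_zero {z : ℂ} (hz : jacobiDen' p z ≠ 0) :
    ∀ᶠ w in nhds z, jacobiDen' p w ≠ 0 :=
  h.continuous_jacobiDen'.continuousAt.eventually_ne hz

/-- Poles are isolated: they are zeros of nd, and there nd has the nonzero derivative p² sd cd. -/
lemma eventually_jacobiDen_ne_zero (z : ℂ) :
    ∀ᶠ w in nhdsWithin z {z}ᶜ, jacobiDen p w ≠ 0 := by
  by_cases hz : jacobiDen p z = 0
  · have hz' := h.jacobiDen'_ne_zero_of_jacobiDen_eq_zero hz
    have hp : (p : ℂ) ≠ 0 := by exact_mod_cast h.left.1.ne'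
    have := (h.hasDerivAt_jacobiNd hz').eventually_ne (c := 0)
      (mul_ne_zero (mul_ne_zero (pow_ne_zero 2 hp) (h.jacobiSd_ne_zero_of_jacobiDen_eq_zero hz))
        (h.jacobiCd_ne_zero_of_jacobiDen_eq_zero hz))
    filter_upwards [this] with w hw h0
    exact hw (h.jacobiNd_eq_zero h0)
  · exact (h.continuous_jacobiDen.continuousAt.eventually_ne hz).filter_mono nhdsWithin_le_nhds

lemma eventually_ne_zero {z : ℂ} (hz : jacobiDen' p z ≠ 0) :
    ∀ᶠ w in nhdsWithin z {z}ᶜ, jacobiDen p w ≠ 0 ∧ jacobiDen' p w ≠ 0 :=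
  (h.eventually_jacobiDen_ne_zero z).and
    ((h.eventually_jacobiDen'_ne_zero hz).filter_mono nhdsWithin_le_nhds)

lemma tendsto_jacobiDn {z : ℂ} (hz : jacobiDen p z = 0) :
    Filter.Tendsto (jacobiDn p) (nhdsWithin z {z}ᶜ) (Bornology.cobounded ℂ) := by
  have hz' := h.jacobiDen'_ne_zero_of_jacobiDen_eq_zero hz
  have hev := h.eventually_ne_zero hz'
  have h1 : Filter.Tendsto (jacobiNd p) (nhdsWithin z {z}ᶜ) (nhdsWithin 0 {0}ᶜ) := by
    refine tendsto_nhdsWithin_iff.2 ⟨?_, ?_⟩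
    · rw [← h.jacobiNd_eq_zero hz]
      exact (h.hasDerivAt_jacobiNd hz').continuousAt.tendsto.mono_left nhdsWithin_le_nhds
    · filter_upwards [hev] with w hw
      exact left_ne_zero_of_mul_eq_one (h.jacobiNd_mul_jacobiDn hw.1 hw.2)
  refine (Filter.tendsto_inv₀_nhdsNE_zero.comp h1).congr' ?_
  filter_upwards [hev] with w hw
  exact inv_eq_of_mul_eq_one_right (h.jacobiNd_mul_jacobiDn hw.1 hw.2)

/-- Transfers the pole of dn to sn and cn, with g = sd and g = cd finite and nonzero there. -/
lemma tendsto_cobounded_of_eq_mul {f g : ℂ → ℂ} {z : ℂ} (hz : jacobiDen p z = 0)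
    (hg : ContinuousAt g z) (hg0 : g z ≠ 0)
    (hf : ∀ w, jacobiDen p w ≠ 0 → jacobiDen' p w ≠ 0 → f w = g w * jacobiDn p w) :
    Filter.Tendsto f (nhdsWithin z {z}ᶜ) (Bornology.cobounded ℂ) := by
  have hz' := h.jacobiDen'_ne_zero_of_jacobiDen_eq_zero hz
  rw [← tendsto_norm_atTop_iff_cobounded]
  have h1 := (hg.norm.tendsto.mono_left (nhdsWithin_le_nhds (s := {z}ᶜ))).pos_mul_atTop
    (norm_pos_iff.2 hg0) (tendsto_norm_atTop_iff_cobounded.2 (h.tendsto_jacobiDn hz))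
  refine h1.congr' ?_
  filter_upwards [h.eventually_ne_zero hz'] with w hw
  rw [hf w hw.1 hw.2, norm_mul]

lemma analyticAt_jacobiCd {z : ℂ} (hz : jacobiDen' p z ≠ 0) : AnalyticAt ℂ (jacobiCd p) z :=
  Complex.analyticAt_iff_eventually_differentiableAt.2 <|
    (h.eventually_jacobiDen'_ne_zero hz).mono fun _ hw => (h.hasDerivAt_jacobiCd hw).differentiableAt

lemma analyticAt_jacobiSd {z : ℂ} (hz : jacobiDen' p z ≠ 0) : AnalyticAt ℂ (jacobiSd p) z :=
  Complex.analyticAt_iff_eventually_differentiableAt.2 <|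
    (h.eventually_jacobiDen'_ne_zero hz).mono fun _ hw => (h.hasDerivAt_jacobiSd hw).differentiableAt

lemma analyticAt_jacobiNd {z : ℂ} (hz : jacobiDen' p z ≠ 0) : AnalyticAt ℂ (jacobiNd p) z :=
  Complex.analyticAt_iff_eventually_differentiableAt.2 <|
    (h.eventually_jacobiDen'_ne_zero hz).mono fun _ hw => (h.hasDerivAt_jacobiNd hw).differentiableAt

lemma meromorphicAt_of_eq_mul {f g : ℂ → ℂ} {z : ℂ} (hz : jacobiDen p z = 0)
    (hg : AnalyticAt ℂ g z)
    (hf : ∀ w, jacobiDen p w ≠ 0 → jacobiDen' p w ≠ 0 → f w = g w * jacobiDn p w) :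
    MeromorphicAt f z := by
  have hz' := h.jacobiDen'_ne_zero_of_jacobiDen_eq_zero hz
  refine (hg.meromorphicAt.mul (h.analyticAt_jacobiNd hz').meromorphicAt.inv).congr ?_
  filter_upwards [h.eventually_ne_zero hz'] with w hw
  rw [hf w hw.1 hw.2, Pi.mul_apply, Pi.inv_apply,
    inv_eq_of_mul_eq_one_right (h.jacobiNd_mul_jacobiDn hw.1 hw.2)]

lemma meromorphicAt_of_hasDerivAt {f f' : ℂ → ℂ} {z : ℂ} (hz : jacobiDen p z ≠ 0)
    (hf : ∀ w, jacobiDen p w ≠ 0 → HasDerivAt f (f' w) w) : MeromorphicAt f z :=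
  (Complex.analyticAt_iff_eventually_differentiableAt.2 <|
    (h.continuous_jacobiDen.continuousAt.eventually_ne hz).mono
      fun w hw => (hf w hw).differentiableAt).meromorphicAt

theorem isJacobiTriple :
    IsJacobiTriple p (jacobiPoles p) (jacobiSn p) (jacobiCn p) (jacobiDn p) where
  meromorphic z := by
    by_cases hz : jacobiDen p z = 0
    · have hz' := h.jacobiDen'_ne_zero_of_jacobiDen_eq_zero hz
      exact ⟨h.meromorphicAt_of_eq_mul hz (h.analyticAt_jacobiSd hz') fun w => h.jacobiSn_eq,
        h.meromorphicAt_of_eq_mul hz (h.analyticAt_jacobiCd hz') fun w => h.jacobiCn_eq,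
        h.meromorphicAt_of_eq_mul hz analyticAt_const fun w _ _ => (one_mul _).symm⟩
    · exact ⟨h.meromorphicAt_of_hasDerivAt hz fun w => h.hasDerivAt_jacobiSn,
        h.meromorphicAt_of_hasDerivAt hz fun w => h.hasDerivAt_jacobiCn,
        h.meromorphicAt_of_hasDerivAt hz fun w => h.hasDerivAt_jacobiDn⟩
  pole z hz := by
    have hz' := h.jacobiDen'_ne_zero_of_jacobiDen_eq_zero hz
    exact ⟨h.tendsto_cobounded_of_eq_mul hz (h.analyticAt_jacobiSd hz').continuousAt
        (h.jacobiSd_ne_zero_of_jacobiDen_eq_zero hz) fun w => h.jacobiSn_eq,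
      h.tendsto_cobounded_of_eq_mul hz (h.analyticAt_jacobiCd hz').continuousAt
        (h.jacobiCd_ne_zero_of_jacobiDen_eq_zero hz) fun w => h.jacobiCn_eq,
      h.tendsto_jacobiDn hz⟩
  zero_notMem := by
    simp [jacobiPoles, jacobiDen, h.compMod_eq, realSn_zero h.left, realCn_zero h.right]
  sn_zero := by simp [jacobiSn, h.compMod_eq, realSn_zero h.left, realSn_zero h.right]
  cn_zero := by
    simp [jacobiCn, jacobiDen, h.compMod_eq, realSn_zero h.left, realSn_zero h.right,
      realCn_zero h.left, realCn_zero h.right]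
  dn_zero := by
    simp [jacobiDn, jacobiDen, h.compMod_eq, realSn_zero h.left, realSn_zero h.right,
      realCn_zero h.right, realDn]
  deriv_sn z hz := h.hasDerivAt_jacobiSn hz
  deriv_cn z hz := h.hasDerivAt_jacobiCn hz
  deriv_dn z hz := h.hasDerivAt_jacobiDn hz

end IsModulusPair

/-! ### Values of `artanh` and `arctan` through the exponential function -/

/-- This is tanh w = (e^{2w} - 1)/(e^{2w} + 1) with denominators cleared, so it stays valid for b =
0. -/
lemma isArtanhQuot_iff {w a b : ℂ} :
    IsArtanhQuot w a b ↔ (b - a) * Complex.exp (2 * w) = b + a := by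
  have h1 : Complex.exp (2 * w) = Complex.exp w * Complex.exp w := by
    rw [← Complex.exp_add, two_mul]
  have h2 : Complex.exp w * Complex.exp (-w) = 1 := by rw [← Complex.exp_add]; simp
  have h0 := Complex.exp_ne_zero w
  rw [IsArtanhQuot, Complex.cosh, Complex.sinh, h1]
  constructor <;> intro h
  · linear_combination (-2 * Complex.exp w) * h + (a + b) * h2
  · apply mul_left_cancel₀ h0
    linear_combination (-1 / 2 : ℂ) * h + (a + b) / 2 * h2

/-- Since tanh(iw) = i tan w, this is the previous criterion at iw for the quotient ia/b. -/
lemma isArctanQuot_iff {w a b : ℂ} :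
    IsArctanQuot w a b ↔
      (b - Complex.I * a) * Complex.exp (2 * (w * Complex.I)) = b + Complex.I * a := by
  rw [← isArtanhQuot_iff, IsArctanQuot, IsArtanhQuot, Complex.cosh_mul_I, Complex.sinh_mul_I]
  constructor <;> intro h
  · linear_combination Complex.I * h
  · apply mul_left_cancel₀ Complex.I_ne_zero
    linear_combination h

/-! ### The exponential factors of the parametrization -/

/-- A square root of `-exp (2 artanh (1 / (p sn)))`. -/
def scherkExp₁ (p : ℝ) (z : ℂ) : ℂ := jacobiNd p z + p * jacobiSd p z

/-- A square root of `exp (2 i arctan (q / (p cn)))`. -/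
def scherkExp₂ (p q : ℝ) (z : ℂ) : ℂ := p * jacobiCd p z + Complex.I * q * jacobiNd p z

/-- A square root of `exp (2 artanh ((q / i) (sn / cn)))`. -/
def scherkExp₃ (p q : ℝ) (z : ℂ) : ℂ := jacobiCd p z - Complex.I * q * jacobiSd p z

/-- The point `x` is a value at `z` of the multivalued parametrization; this makes sense at the
poles as well. -/
structure IsScherkValue (p q : ℝ) (z : ℂ) (x : E3) : Prop where
  fst : Real.exp (p * x 0) = ‖scherkExp₁ p z‖ ^ 2
  snd : Complex.exp ((p * q * x 1 : ℝ) * Complex.I) * (‖scherkExp₂ p q z‖ : ℂ) ^ 2 =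
    scherkExp₂ p q z ^ 2
  trd : Real.exp (q * x 2) = ‖scherkExp₃ p q z‖ ^ 2

namespace IsModulusPair

variable {p q : ℝ} (h : IsModulusPair p q)
include h

/-! ### Inverses and logarithmic derivatives of the exponential factors. -/

/-- Difference of squares: N² - p²S² = 1. The next two use p²C² + q²N² = 1 and C² + q²S² = 1. The
inverse obtained by changing one sign shows that the factor has no zeros, and it also enters the
equation of the tower. -/
lemma scherkExp₁_mul {z : ℂ} (hz : jacobiDen' p z ≠ 0) :
    scherkExp₁ p z * (jacobiNd p z - p * jacobiSd p z) = 1 := by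
  rw [scherkExp₁]
  linear_combination h.jacobiNd_sq hz

lemma scherkExp₂_mul {z : ℂ} (hz : jacobiDen' p z ≠ 0) :
    scherkExp₂ p q z * (p * jacobiCd p z - Complex.I * q * jacobiNd p z) = 1 := by
  rw [scherkExp₂]
  linear_combination (q : ℂ) ^ 2 * h.jacobiNd_sq hz + (p : ℂ) ^ 2 * h.jacobiCd_sq hz +
    h.ofReal_sq_add_sq - q ^ 2 * jacobiNd p z ^ 2 * Complex.I_sq

lemma scherkExp₃_mul {z : ℂ} (hz : jacobiDen' p z ≠ 0) :
    scherkExp₃ p q z * (jacobiCd p z + Complex.I * q * jacobiSd p z) = 1 := by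
  rw [scherkExp₃]
  linear_combination h.jacobiCd_sq hz - q ^ 2 * jacobiSd p z ^ 2 * Complex.I_sq

lemma scherkExp₁_ne_zero {z : ℂ} (hz : jacobiDen' p z ≠ 0) : scherkExp₁ p z ≠ 0 :=
  left_ne_zero_of_mul_eq_one (h.scherkExp₁_mul hz)

lemma scherkExp₂_ne_zero {z : ℂ} (hz : jacobiDen' p z ≠ 0) : scherkExp₂ p q z ≠ 0 :=
  left_ne_zero_of_mul_eq_one (h.scherkExp₂_mul hz)

lemma scherkExp₃_ne_zero {z : ℂ} (hz : jacobiDen' p z ≠ 0) : scherkExp₃ p q z ≠ 0 :=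
  left_ne_zero_of_mul_eq_one (h.scherkExp₃_mul hz)

lemma hasDerivAt_scherkExp₁ {z : ℂ} (hz : jacobiDen' p z ≠ 0) :
    HasDerivAt (scherkExp₁ p) (p * jacobiCd p z * scherkExp₁ p z) z := by
  refine ((h.hasDerivAt_jacobiNd hz).add ((h.hasDerivAt_jacobiSd hz).const_mul (p : ℂ))).congr_deriv
    ?_
  rw [scherkExp₁]; ring

lemma hasDerivAt_scherkExp₂ {z : ℂ} (hz : jacobiDen' p z ≠ 0) :
    HasDerivAt (scherkExp₂ p q) (Complex.I * (p * q * jacobiSd p z) * scherkExp₂ p q z) z := by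
  refine (((h.hasDerivAt_jacobiCd hz).const_mul (p : ℂ)).add
    ((h.hasDerivAt_jacobiNd hz).const_mul (Complex.I * q))).congr_deriv ?_
  rw [scherkExp₂]
  linear_combination -(p : ℂ) * q ^ 2 * jacobiSd p z * jacobiNd p z * Complex.I_sq

lemma hasDerivAt_scherkExp₃ {z : ℂ} (hz : jacobiDen' p z ≠ 0) :
    HasDerivAt (scherkExp₃ p q) (-(Complex.I * q * jacobiNd p z) * scherkExp₃ p q z) z := by
  refine ((h.hasDerivAt_jacobiCd hz).sub
    ((h.hasDerivAt_jacobiSd hz).const_mul (Complex.I * q))).congr_deriv ?_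
  rw [scherkExp₃]
  linear_combination -(q : ℂ) ^ 2 * jacobiSd p z * jacobiNd p z * Complex.I_sq

/-- After division by dn the condition reads e^{2w} = (pS + N)/(pS - N), whose denominator is -1/E₁.
The minus sign only shifts Im w, which does not enter the parametrization. -/
lemma isArtanhQuot_fst_iff {z w : ℂ} (hz : jacobiDen p z ≠ 0) (hz' : jacobiDen' p z ≠ 0) :
    IsArtanhQuot w 1 (p * jacobiSn p z) ↔ Complex.exp (2 * w) = -scherkExp₁ p z ^ 2 := by
  have hN := h.jacobiNd_mul_jacobiDn hz hz'
  have hm := h.scherkExp₁_mul hz'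
  have hd := h.jacobiDn_ne_zero hz hz'
  have he := h.scherkExp₁_ne_zero hz'
  rw [isArtanhQuot_iff, h.jacobiSn_eq hz hz', ← hN]
  simp only [scherkExp₁] at *
  constructor <;> intro hw
  · apply mul_left_cancel₀ hd
    linear_combination -(jacobiNd p z + p * jacobiSd p z) * hw
      - jacobiDn p z * Complex.exp (2 * w) * hm
  · apply mul_left_cancel₀ he
    linear_combination -jacobiDn p z * hw - jacobiDn p z * Complex.exp (2 * w) * hm

/-- Here e^{2iw} = (pC + iqN)/(pC - iqN), and the denominator is 1/E₂. -/
lemma isArctanQuot_snd_iff {z w : ℂ} (hz : jacobiDen p z ≠ 0) (hz' : jacobiDen' p z ≠ 0) :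
    IsArctanQuot w q (p * jacobiCn p z) ↔
      Complex.exp (2 * (w * Complex.I)) = scherkExp₂ p q z ^ 2 := by
  have hN := h.jacobiNd_mul_jacobiDn hz hz'
  have hm := h.scherkExp₂_mul hz'
  have hd := h.jacobiDn_ne_zero hz hz'
  have he := h.scherkExp₂_ne_zero hz'
  rw [isArctanQuot_iff, h.jacobiCn_eq hz hz', ← mul_one (q : ℂ), ← hN]
  simp only [scherkExp₂] at *
  constructor <;> intro hw
  · apply mul_left_cancel₀ hd
    linear_combination (p * jacobiCd p z + Complex.I * q * jacobiNd p z) * hw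
      - jacobiDn p z * Complex.exp (2 * (w * Complex.I)) * hm
  · apply mul_left_cancel₀ he
    linear_combination jacobiDn p z * hw
      + jacobiDn p z * Complex.exp (2 * (w * Complex.I)) * hm

lemma isArtanhQuot_trd_iff {z w : ℂ} (hz : jacobiDen p z ≠ 0) (hz' : jacobiDen' p z ≠ 0) :
    IsArtanhQuot w ((q / Complex.I) * jacobiSn p z) (jacobiCn p z) ↔
      Complex.exp (2 * w) = scherkExp₃ p q z ^ 2 := by
  have hm := h.scherkExp₃_mul hz'
  have hd := h.jacobiDn_ne_zero hz hz'
  have he := h.scherkExp₃_ne_zero hz'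
  rw [isArtanhQuot_iff, h.jacobiCn_eq hz hz', h.jacobiSn_eq hz hz', Complex.div_I]
  simp only [scherkExp₃] at *
  constructor <;> intro hw
  · apply mul_left_cancel₀ hd
    linear_combination (jacobiCd p z - Complex.I * q * jacobiSd p z) * hw
      - jacobiDn p z * Complex.exp (2 * w) * hm
  · apply mul_left_cancel₀ he
    linear_combination jacobiDn p z * hw + jacobiDn p z * Complex.exp (2 * w) * hm

/-- Off the poles, the values of the parametrization are those of the multivalued formula. -/
lemma isScherkValue_iff {z : ℂ} {x : E3} (hz : jacobiDen p z ≠ 0) (hz' : jacobiDen' p z ≠ 0) :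
    IsScherkValue p q z x ↔ ∃ w₁ w₂ w₃ : ℂ,
      IsArtanhQuot w₁ 1 (p * jacobiSn p z) ∧
      IsArctanQuot w₂ q (p * jacobiCn p z) ∧
      IsArtanhQuot w₃ ((q / Complex.I) * jacobiSn p z) (jacobiCn p z) ∧
      x = (2 / (p * q)) • !₂[q * w₁.re, w₂.re, p * w₃.re] := by
  have hp := h.left.1.ne'
  have hq := h.right.1.ne'
  simp only [h.isArtanhQuot_fst_iff hz hz', h.isArctanQuot_snd_iff hz hz',
    h.isArtanhQuot_trd_iff hz hz']
  constructor
  · rintro ⟨h1, h2, h3⟩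
    have he1 := h.scherkExp₁_ne_zero hz'
    have he2 := h.scherkExp₂_ne_zero hz'
    have he3 := h.scherkExp₃_ne_zero hz'
    -- The real part of w₂ is prescribed by x₂; its imaginary part is chosen so that e^{2iw₂} has
    -- modulus |E₂|².
    refine ⟨Complex.log (-scherkExp₁ p z ^ 2) / 2,
      (p * q * x 1 / 2 : ℝ) - Complex.I * (Real.log ‖scherkExp₂ p q z‖ : ℝ),
      Complex.log (scherkExp₃ p q z ^ 2) / 2, ?_, ?_, ?_, ?_⟩
    · rw [mul_div_cancel₀ _ two_ne_zero, Complex.exp_log (neg_ne_zero.2 (pow_ne_zero 2 he1))]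
    · rw [← h2]
      have : (‖scherkExp₂ p q z‖ : ℂ) = Complex.exp (Real.log ‖scherkExp₂ p q z‖ : ℝ) := by
        rw [← Complex.ofReal_exp, Real.exp_log (norm_pos_iff.2 he2)]
      rw [this, sq, ← Complex.exp_add, ← Complex.exp_add]
      congr 1
      push_cast
      linear_combination -2 * (Real.log ‖scherkExp₂ p q z‖ : ℂ) * Complex.I_sq
    · rw [mul_div_cancel₀ _ two_ne_zero, Complex.exp_log (pow_ne_zero 2 he3)]
    · have h1' := congrArg Real.log h1
      have h3' := congrArg Real.log h3
      rw [Real.log_exp, Real.log_pow] at h1' h3'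
      push_cast at h1' h3'
      ext j
      fin_cases j
      · simp [Complex.log_re]
        field_simp
        linarith
      · simp
        field_simp
      · simp [Complex.log_re]
        field_simp
        linarith
  · rintro ⟨w₁, w₂, w₃, h1, h2, h3, rfl⟩
    have e1 : Real.exp (2 * w₁.re) = ‖scherkExp₁ p z‖ ^ 2 := by
      have := congrArg norm h1
      simpa [Complex.norm_exp] using this
    have e3 : Real.exp (2 * w₃.re) = ‖scherkExp₃ p q z‖ ^ 2 := by
      have := congrArg norm h3
      simpa [Complex.norm_exp] using this
    have e2 : Real.exp (-(2 * w₂.im)) = ‖scherkExp₂ p q z‖ ^ 2 := by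
      have := congrArg norm h2
      simpa [Complex.norm_exp] using this
    refine ⟨?_, ?_, ?_⟩
    · rw [← e1]; congr 1; simp; field_simp
    · rw [← h2, ← Complex.ofReal_pow, ← e2, Complex.ofReal_exp, ← Complex.exp_add]
      congr 1
      have : p * q * ((2 / (p * q)) • !₂[q * w₁.re, w₂.re, p * w₃.re] : E3) 1 = 2 * w₂.re := by
        simp; field_simp
      rw [this]
      apply Complex.ext <;> simp
    · rw [← e3]; congr 1; simp; field_simp

lemma continuousAt_scherkExp₁ {z : ℂ} (hz : jacobiDen' p z ≠ 0) : ContinuousAt (scherkExp₁ p) z :=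
  (h.hasDerivAt_scherkExp₁ hz).continuousAt

lemma continuousAt_scherkExp₂ {z : ℂ} (hz : jacobiDen' p z ≠ 0) :
    ContinuousAt (scherkExp₂ p q) z :=
  (h.hasDerivAt_scherkExp₂ hz).continuousAt

lemma continuousAt_scherkExp₃ {z : ℂ} (hz : jacobiDen' p z ≠ 0) :
    ContinuousAt (scherkExp₃ p q) z :=
  (h.hasDerivAt_scherkExp₃ hz).continuousAt

/-- A branch is constrained only off the poles. Poles are isolated and both sides of each equation
in `IsScherkValue` are continuous along X, so the equations persist at the poles by passing to the
limit. -/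
lemma isScherkBranch_iff {U : Set ℂ} (hU : IsOpen U) (hUD : U ⊆ scherkDomain p) {X : ℂ → E3} :
    IsScherkBranch p q U X ↔ ContinuousOn X U ∧ ∀ z ∈ U, IsScherkValue p q z (X z) := by
  constructor
  · rintro ⟨hc, hv⟩
    refine ⟨hc, fun z hz => ?_⟩
    have hz' := h.mem_scherkDomain.1 (hUD hz)
    have hX : ContinuousAt X z := hc.continuousAt (hU.mem_nhds hz)
    have hXj (j : Fin 3) : ContinuousAt (fun w => X w j) z :=
      (EuclideanSpace.proj (𝕜 := ℝ) j).continuous.continuousAt.comp hX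
    have c1 := h.continuousAt_scherkExp₁ hz'
    have c2 := h.continuousAt_scherkExp₂ hz'
    have c3 := h.continuousAt_scherkExp₃ hz'
    have x0 := hXj 0
    have x1 := hXj 1
    have x2 := hXj 2
    have hev : ∀ᶠ w in nhdsWithin z {z}ᶜ, IsScherkValue p q w (X w) := by
      filter_upwards [h.eventually_ne_zero hz',
        mem_nhdsWithin_of_mem_nhds (hU.mem_nhds hz)] with w hw hwU
      exact (h.isScherkValue_iff hw.1 hw.2).2 (hv w hwU hw.1)
    have key {α : Type} [TopologicalSpace α] [T2Space α] {f g : ℂ → α} (hf : ContinuousAt f z)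
        (hg : ContinuousAt g z) (hfg : ∀ w, IsScherkValue p q w (X w) → f w = g w) : f z = g z := by
      refine tendsto_nhds_unique_of_eventuallyEq (l := nhdsWithin z {z}ᶜ)
        (hf.tendsto.mono_left nhdsWithin_le_nhds) (hg.tendsto.mono_left nhdsWithin_le_nhds) ?_
      filter_upwards [hev] with w hw using hfg w hw
    exact ⟨key (f := fun w => Real.exp (p * X w 0)) (g := fun w => ‖scherkExp₁ p w‖ ^ 2)
        (by fun_prop) (by fun_prop) fun w hw => hw.fst,
      key (f := fun w => Complex.exp ((p * q * X w 1 : ℝ) * Complex.I) *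
          (‖scherkExp₂ p q w‖ : ℂ) ^ 2) (g := fun w => scherkExp₂ p q w ^ 2)
        (by fun_prop) (by fun_prop) fun w hw => hw.snd,
      key (f := fun w => Real.exp (q * X w 2)) (g := fun w => ‖scherkExp₃ p q w‖ ^ 2)
        (by fun_prop) (by fun_prop) fun w hw => hw.trd⟩
  · rintro ⟨hc, hv⟩
    exact ⟨hc, fun z hz hzP =>
      (h.isScherkValue_iff hzP (h.mem_scherkDomain.1 (hUD hz))).1 (hv z hz)⟩

/-! ### Existence of branches -/

/-- Only the second coordinate needs a choice: on simply connected U the zero-free factor E₂ has a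
continuous logarithm f, and 2 Im f serves as p q x₂. The prescribed value at z₀ is what surjectivity
onto the tower requires. -/
theorem exists_isScherkBranch_apply_eq {U : Set ℂ} (hU : IsOpen U) (hUD : U ⊆ scherkDomain p)
    (hUs : IsSimplyConnected U) {z₀ : ℂ} (hz₀ : z₀ ∈ U) {x : E3} (hx : IsScherkValue p q z₀ x) :
    ∃ X : ℂ → E3, IsScherkBranch p q U X ∧ X z₀ = x := by
  have hp := h.left.1.ne'
  have hq := h.right.1.ne'
  have hne (z) (hz : z ∈ U) : jacobiDen' p z ≠ 0 := h.mem_scherkDomain.1 (hUD hz)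
  obtain ⟨f, hf, hfE⟩ := Complex.exists_continuousOn_eqOn_exp_comp hUs hU (g := scherkExp₂ p q)
    (fun z hz => (h.continuousAt_scherkExp₂ (hne z hz)).continuousWithinAt)
    (by rintro ⟨z, hz, h0⟩; exact h.scherkExp₂_ne_zero (hne z hz) h0)
  have hfE' (z) (hz : z ∈ U) : Complex.exp ((2 * (f z).im : ℝ) * Complex.I) *
      (‖scherkExp₂ p q z‖ : ℂ) ^ 2 = scherkExp₂ p q z ^ 2 := by
    have := hfE hz
    simp only [Function.comp_apply] at this
    rw [← this, Complex.norm_exp, sq, sq, Complex.ofReal_exp, ← Complex.exp_add, ← Complex.exp_add,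
      ← Complex.exp_add]
    congr 1
    apply Complex.ext <;> simp
    ring
  have hE0 : (‖scherkExp₂ p q z₀‖ : ℂ) ^ 2 ≠ 0 := by
    simpa using h.scherkExp₂_ne_zero (hne z₀ hz₀)
  -- The wanted value and 2 Im f(z₀) agree modulo 2π; the same multiple is then added on all of U.
  obtain ⟨n, hn⟩ := Complex.exp_eq_exp_iff_exists_int.1
    (mul_right_cancel₀ hE0 (hx.snd.trans (hfE' z₀ hz₀).symm))
  have hn' : p * q * x 1 = 2 * (f z₀).im + n * (2 * Real.pi) := by
    have := congrArg Complex.im hn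
    simpa using this
  let X : ℂ → E3 := fun z => !₂[2 / p * Real.log ‖scherkExp₁ p z‖,
    (2 * (f z).im + n * (2 * Real.pi)) / (p * q), 2 / q * Real.log ‖scherkExp₃ p q z‖]
  refine ⟨X, (h.isScherkBranch_iff hU hUD).2 ⟨?_, fun z hz => ⟨?_, ?_, ?_⟩⟩, ?_⟩
  · refine (PiLp.continuous_toLp 2 _).comp_continuousOn (continuousOn_pi.2 fun j => ?_)
    have c1 : ContinuousOn (fun z => Real.log ‖scherkExp₁ p z‖) U := fun z hz =>
      ((h.continuousAt_scherkExp₁ (hne z hz)).norm.log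
        (norm_ne_zero_iff.2 (h.scherkExp₁_ne_zero (hne z hz)))).continuousWithinAt
    have c3 : ContinuousOn (fun z => Real.log ‖scherkExp₃ p q z‖) U := fun z hz =>
      ((h.continuousAt_scherkExp₃ (hne z hz)).norm.log
        (norm_ne_zero_iff.2 (h.scherkExp₃_ne_zero (hne z hz)))).continuousWithinAt
    have c2 : ContinuousOn (fun z => (f z).im) U := Complex.continuous_im.comp_continuousOn hf
    fin_cases j
    · simpa using! c1.const_mul (2 / p)
    · simpa using! ((c2.const_mul 2).add continuousOn_const).div_const (p * q)
    · simpa using! c3.const_mul (2 / q)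
  · have := norm_pos_iff.2 (h.scherkExp₁_ne_zero (hne z hz))
    simp only [X, Matrix.cons_val_zero]
    rw [show p * (2 / p * Real.log ‖scherkExp₁ p z‖) = (2 : ℕ) * Real.log ‖scherkExp₁ p z‖ by
      push_cast; field_simp, Real.exp_nat_mul, Real.exp_log this]
  · rw [← hfE' z hz]
    congr 1
    simp only [X, Matrix.cons_val_one, Matrix.cons_val_zero]
    rw [mul_div_cancel₀ _ (mul_ne_zero hp hq), Complex.exp_eq_exp_iff_exists_int]
    exact ⟨n, by push_cast; ring⟩
  · have := norm_pos_iff.2 (h.scherkExp₃_ne_zero (hne z hz))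
    simp only [X, Matrix.cons_val]
    rw [show q * (2 / q * Real.log ‖scherkExp₃ p q z‖) = (2 : ℕ) * Real.log ‖scherkExp₃ p q z‖ by
      push_cast; field_simp, Real.exp_nat_mul, Real.exp_log this]
  · have h1 := congrArg Real.log hx.fst
    have h3 := congrArg Real.log hx.trd
    rw [Real.log_exp, Real.log_pow] at h1 h3
    push_cast at h1 h3
    ext j
    fin_cases j
    · simp [X]
      field_simp
      linarith
    · simp [X]
      rw [← hn']
      field_simp
    · simp [X]
      field_simp
      linarith

/-- Every point of the domain carries a value of the parametrization. -/
lemma exists_isScherkValue {z : ℂ} (hz : jacobiDen' p z ≠ 0) : ∃ x, IsScherkValue p q z x := by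
  have hp := h.left.1.ne'
  have hq := h.right.1.ne'
  refine ⟨!₂[2 / p * Real.log ‖scherkExp₁ p z‖, 2 * (scherkExp₂ p q z).arg / (p * q),
    2 / q * Real.log ‖scherkExp₃ p q z‖], ?_, ?_, ?_⟩
  · have := norm_pos_iff.2 (h.scherkExp₁_ne_zero hz)
    simp only [Matrix.cons_val_zero]
    rw [show p * (2 / p * Real.log ‖scherkExp₁ p z‖) = (2 : ℕ) * Real.log ‖scherkExp₁ p z‖ by
      push_cast; field_simp, Real.exp_nat_mul, Real.exp_log this]
  · simp only [Matrix.cons_val_one, Matrix.cons_val_zero]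
    rw [mul_div_cancel₀ _ (mul_ne_zero hp hq)]
    have := Complex.norm_mul_exp_arg_mul_I (scherkExp₂ p q z)
    conv_rhs => rw [← this]
    rw [mul_pow, ← Complex.exp_nat_mul, mul_comm]
    congr 2
    push_cast; ring
  · have := norm_pos_iff.2 (h.scherkExp₃_ne_zero hz)
    simp only [Matrix.cons_val]
    rw [show q * (2 / q * Real.log ‖scherkExp₃ p q z‖) = (2 : ℕ) * Real.log ‖scherkExp₃ p q z‖ by
      push_cast; field_simp, Real.exp_nat_mul, Real.exp_log this]

theorem exists_isScherkBranch {U : Set ℂ} (hU : IsOpen U) (hUD : U ⊆ scherkDomain p)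
    (hUs : IsSimplyConnected U) : ∃ X : ℂ → E3, IsScherkBranch p q U X := by
  obtain ⟨z, hz⟩ := hUs.nonempty
  obtain ⟨x, hx⟩ := h.exists_isScherkValue (h.mem_scherkDomain.1 (hUD hz))
  obtain ⟨X, hX, -⟩ := h.exists_isScherkBranch_apply_eq hU hUD hUs hz hx
  exact ⟨X, hX⟩

end IsModulusPair

/-! ### Differentials of branches of logarithms -/

/-- Normalizing by E z₀ moves the argument to 1, where the principal logarithm is differentiable. -/
lemma hasDerivAt_log_div {E : ℂ → ℂ} {c z₀ : ℂ} (h0 : E z₀ ≠ 0) (hE : HasDerivAt E (c * E z₀) z₀) :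
    HasDerivAt (fun z => Complex.log (E z / E z₀)) c z₀ := by
  refine ((hE.div_const (E z₀)).clog (by simp [h0])).congr_deriv ?_
  field_simp

lemma hasFDerivAt_re {F : ℂ → ℂ} {c z₀ : ℂ} (hF : HasDerivAt F c z₀) :
    HasFDerivAt (fun z => (F z).re) (Complex.reCLM.comp (ContinuousLinearMap.mul ℝ ℂ c)) z₀ := by
  refine (Complex.reCLM.hasFDerivAt.comp z₀ (hF.hasFDerivAt.restrictScalars ℝ)).congr_fderiv ?_
  ext w
  simp [mul_comm]

/-- Up to a constant, x is (2/r) Re log E near z₀, and c is the logarithmic derivative of E. -/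
lemma hasFDerivAt_of_exp_eq_norm_sq {E : ℂ → ℂ} {x : ℂ → ℝ} {r : ℝ} {c z₀ : ℂ} (hr : r ≠ 0)
    (h0 : E z₀ ≠ 0) (hE : HasDerivAt E (c * E z₀) z₀)
    (hx : ∀ᶠ z in nhds z₀, Real.exp (r * x z) = ‖E z‖ ^ 2) :
    HasFDerivAt x (Complex.reCLM.comp (ContinuousLinearMap.mul ℝ ℂ (2 / r * c))) z₀ := by
  have h1 := hasFDerivAt_re ((hasDerivAt_log_div h0 hE).const_mul (2 / r : ℂ))
  have h2 := h1.add_const (x z₀)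
  refine h2.congr_of_eventuallyEq ?_
  filter_upwards [hx, hE.continuousAt.eventually_ne h0] with z hz hz0
  have e1 := congrArg Real.log hz
  have e2 := congrArg Real.log hx.self_of_nhds
  rw [Real.log_exp, Real.log_pow] at e1 e2
  have e3 : ((2 / r : ℂ) * Complex.log (E z / E z₀)).re = 2 / r * Real.log (‖E z‖ / ‖E z₀‖) := by
    rw [show (2 / r : ℂ) = ((2 / r : ℝ) : ℂ) by push_cast; rfl, Complex.re_ofReal_mul,
      Complex.log_re, norm_div]
  rw [e3, Real.log_div (norm_ne_zero_iff.2 hz0) (norm_ne_zero_iff.2 h0)]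
  push_cast at e1 e2
  field_simp
  linarith

/-- Near z₀, x is (2/r) Im log E up to a constant. The equation fixes r x only modulo 2π, so
continuity of x is needed to exclude jumps. -/
lemma hasFDerivAt_of_exp_mul_I_mul_norm_sq {E : ℂ → ℂ} {x : ℂ → ℝ} {r : ℝ} {c z₀ : ℂ} (hr : r ≠ 0)
    (h0 : E z₀ ≠ 0) (hE : HasDerivAt E (Complex.I * c * E z₀) z₀) (hxc : ContinuousAt x z₀)
    (hx : ∀ᶠ z in nhds z₀, Complex.exp ((r * x z : ℝ) * Complex.I) * (‖E z‖ : ℂ) ^ 2 = E z ^ 2) :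
    HasFDerivAt x (Complex.reCLM.comp (ContinuousLinearMap.mul ℝ ℂ (2 / r * c))) z₀ := by
  have hL := hasDerivAt_log_div h0 hE
  -- Dividing by i turns the imaginary part of the logarithm into a real part.
  have h1 := hasFDerivAt_re (hL.const_mul (2 / (r * Complex.I) : ℂ))
  have h2 := h1.add_const (x z₀)
  have hr' : (r : ℂ) ≠ 0 := by exact_mod_cast hr
  rw [show (2 / (r * Complex.I) : ℂ) * (Complex.I * c) = 2 / r * c by
    field_simp [Complex.I_ne_zero]] at h2
  refine h2.congr_of_eventuallyEq ?_
  -- The discrepancy θ is a multiple of 2π near z₀, is continuous at z₀ and vanishes there. Once |θ|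
  -- < 1 it must be 0.
  let θ : ℂ → ℝ := fun z => r * x z - r * x z₀ - 2 * (Complex.log (E z / E z₀)).im
  have hθ : ContinuousAt θ z₀ := by
    have := Complex.continuous_im.continuousAt.comp hL.continuousAt
    exact ((hxc.const_mul r).sub continuousAt_const).sub (this.const_mul 2)
  have hθ0 : θ z₀ = 0 := by simp [θ, h0]
  have hsmall : ∀ᶠ z in nhds z₀, |θ z| < 1 := by
    have : ContinuousAt (fun z => |θ z|) z₀ := hθ.abs
    exact this.eventually_lt continuousAt_const (by simp [hθ0])
  filter_upwards [hx, hE.continuousAt.eventually_ne h0, hsmall] with z hz hz0 hs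
  have hz₀ := hx.self_of_nhds
  have hn : (‖E z‖ : ℂ) ≠ 0 := by simpa using hz0
  have hn0 : (‖E z₀‖ : ℂ) ≠ 0 := by simpa using h0
  have hlog : Complex.exp ((2 * (Complex.log (E z / E z₀)).im : ℝ) * Complex.I) *
      (‖E z‖ / ‖E z₀‖ : ℂ) ^ 2 = (E z / E z₀) ^ 2 := by
    have := Complex.norm_mul_exp_arg_mul_I (E z / E z₀)
    conv_rhs => rw [← this]
    rw [mul_pow, ← Complex.exp_nat_mul, mul_comm, norm_div, Complex.log_im]
    push_cast
    congr 2
    ring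
  have hexp : Complex.exp (θ z * Complex.I) = 1 := by
    have e : Complex.exp (θ z * Complex.I) *
        (Complex.exp ((r * x z₀ : ℝ) * Complex.I) *
        Complex.exp ((2 * (Complex.log (E z / E z₀)).im : ℝ) * Complex.I)) =
        Complex.exp ((r * x z : ℝ) * Complex.I) := by
      rw [← Complex.exp_add, ← Complex.exp_add]
      congr 1
      simp only [θ]
      push_cast; ring
    have e1 := (eq_div_iff (pow_ne_zero 2 hn)).2 hz
    have e2 := (eq_div_iff (pow_ne_zero 2 hn0)).2 hz₀
    have e3 := (eq_div_iff (pow_ne_zero 2 (div_ne_zero hn hn0))).2 hlog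
    rw [e1, e2, e3] at e
    field_simp at e
    exact e
  have hθz : θ z = 0 := by
    have hcos : Real.cos (θ z) = 1 := by
      have := congrArg Complex.re hexp
      simpa [Complex.exp_ofReal_mul_I_re] using this
    have hpi := Real.pi_gt_three
    rw [abs_lt] at hs
    exact (Real.cos_eq_one_iff_of_lt_of_lt (by linarith) (by linarith)).1 hcos
  have e3 : ((2 / (r * Complex.I) : ℂ) * Complex.log (E z / E z₀)).re =
      2 / r * (Complex.log (E z / E z₀)).im := by
    rw [show (2 / (r * Complex.I) : ℂ) = ((2 / r : ℝ) : ℂ) * -Complex.I by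
      push_cast; field_simp; simp, mul_assoc, Complex.re_ofReal_mul]
    simp
  rw [e3]
  simp only [θ] at hθz
  field_simp
  linarith

/-! ### Surfaces whose differential is the real part of a holomorphic form -/

/-- `dX = Re (φ dz)` on `U`, where `φ` is holomorphic with derivative `φ'`. -/
structure IsReHolomorphic (U : Set ℂ) (X : ℂ → E3) (φ φ' : ℂ → Fin 3 → ℂ) : Prop where
  diff : ∀ z ∈ U, ∀ j, HasFDerivAt (fun w => X w j)
    (Complex.reCLM.comp (ContinuousLinearMap.mul ℝ ℂ (φ z j))) z
  holo : ∀ z ∈ U, ∀ j, HasDerivAt (fun w => φ w j) (φ' z j) z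

/-- The real part of a complex vector. -/
def reVec (v : Fin 3 → ℂ) : E3 := WithLp.toLp 2 fun j => (v j).re

@[simp] lemma reVec_apply (v : Fin 3 → ℂ) (j : Fin 3) : reVec v j = (v j).re := rfl

namespace IsReHolomorphic

variable {U : Set ℂ} {X : ℂ → E3} {φ φ' : ℂ → Fin 3 → ℂ} (h : IsReHolomorphic U X φ φ')
include h

lemma fderiv_apply {z : ℂ} (hz : z ∈ U) (w : ℂ) :
    fderiv ℝ X z w = reVec (w • φ z) := by
  have hX : HasFDerivAt X ((PiLp.continuousLinearEquiv 2 ℝ (fun _ : Fin 3 => ℝ)).symm.toContinuousLinearMap.comp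
    (ContinuousLinearMap.pi fun j =>
      Complex.reCLM.comp (ContinuousLinearMap.mul ℝ ℂ (φ z j)))) z := by
    rw [← hasFDerivWithinAt_univ, hasFDerivWithinAt_euclidean]
    intro j
    refine HasFDerivAt.hasFDerivWithinAt ?_
    exact (h.diff z hz j).congr_fderiv (by ext; simp)
  rw [hX.fderiv]
  ext j
  simp [mul_comm]

/-- The derivative of `X` in a fixed direction is again the real part of a holomorphic map. -/
lemma fderiv_fderiv_apply (hU : IsOpen U) {z : ℂ} (hz : z ∈ U) (w w' : ℂ) :
    fderiv ℝ (fun y => fderiv ℝ X y w) z w' = reVec ((w' * w) • φ' z) := by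
  have he : (fun y => fderiv ℝ X y w) =ᶠ[nhds z] fun y => reVec (w • φ y) := by
    filter_upwards [hU.mem_nhds hz] with y hy using h.fderiv_apply hy w
  have hX : HasFDerivAt (fun y => reVec (w • φ y))
      ((PiLp.continuousLinearEquiv 2 ℝ (fun _ : Fin 3 => ℝ)).symm.toContinuousLinearMap.comp
    (ContinuousLinearMap.pi fun j =>
      Complex.reCLM.comp (ContinuousLinearMap.mul ℝ ℂ (w * φ' z j)))) z := by
    rw [← hasFDerivWithinAt_univ, hasFDerivWithinAt_euclidean]
    intro j
    refine HasFDerivAt.hasFDerivWithinAt ?_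
    exact (hasFDerivAt_re ((h.holo z hz j).const_mul w)).congr_fderiv (by ext; simp)
  rw [he.fderiv_eq, hX.fderiv]
  ext j
  simp
  ring

lemma contDiffOn (hU : IsOpen U) : ContDiffOn ℝ ∞ X U := by
  rw [contDiffOn_euclidean]
  intro j
  rw [contDiffOn_infty_iff_fderiv_of_isOpen hU]
  refine ⟨fun z hz => (h.diff z hz j).differentiableAt.differentiableWithinAt, ?_⟩
  have hφ : ContDiffOn ℝ ∞ (fun z => φ z j) U :=
    (DifferentiableOn.contDiffOn (fun z hz =>
      (h.holo z hz j).differentiableAt.differentiableWithinAt) hU (n := ∞)).restrict_scalars ℝ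
  have : ContDiffOn ℝ ∞ (fun z => Complex.reCLM.comp (ContinuousLinearMap.mul ℝ ℂ (φ z j))) U :=
    (((ContinuousLinearMap.compL ℝ ℂ ℂ ℝ Complex.reCLM).comp
      (ContinuousLinearMap.mul ℝ ℂ)).contDiff).comp_contDiffOn hφ
  exact this.congr fun z hz => (h.diff z hz j).fderiv

lemma dU_eq {z : ℂ} (hz : z ∈ U) : dU X z = reVec (φ z) := by
  simpa using! h.fderiv_apply hz 1

lemma dV_eq {z : ℂ} (hz : z ∈ U) : dV X z = reVec (Complex.I • φ z) := h.fderiv_apply hz Complex.I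

lemma dU_dU_eq (hU : IsOpen U) {z : ℂ} (hz : z ∈ U) : dU (dU X) z = reVec (φ' z) := by
  simpa using! h.fderiv_fderiv_apply hU hz 1 1

lemma dV_dU_eq (hU : IsOpen U) {z : ℂ} (hz : z ∈ U) :
    dV (dU X) z = reVec (Complex.I • φ' z) := by
  simpa using! h.fderiv_fderiv_apply hU hz 1 Complex.I

lemma dV_dV_eq (hU : IsOpen U) {z : ℂ} (hz : z ∈ U) : dV (dV X) z = reVec (-φ' z) := by
  simpa using! h.fderiv_fderiv_apply hU hz Complex.I Complex.I

/-- With X_u = Re φ and X_v = -Im φ, the real and imaginary parts of φ·φ = 0 are |X_u|² = |X_v|² and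
X_u ⊥ X_v. -/
lemma isConformalParam (hiso : ∀ z ∈ U, φ z 0 ^ 2 + φ z 1 ^ 2 + φ z 2 ^ 2 = 0) :
    IsConformalParam U X := by
  intro z hz
  have hre := congrArg Complex.re (hiso z hz)
  have him := congrArg Complex.im (hiso z hz)
  simp only [sq, Complex.add_re, Complex.mul_re, Complex.zero_re, Complex.add_im, Complex.mul_im,
    Complex.zero_im] at hre him
  rw [h.dU_eq hz, h.dV_eq hz]
  constructor
  · rw [EuclideanSpace.norm_eq, EuclideanSpace.norm_eq]
    congr 1
    simp [Fin.sum_univ_three]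
    linarith
  · simp [PiLp.inner_apply, Fin.sum_univ_three]
    linarith

lemma isRegularSurface (hU : IsOpen U) (hiso : ∀ z ∈ U, φ z 0 ^ 2 + φ z 1 ^ 2 + φ z 2 ^ 2 = 0)
    (hne : ∀ z ∈ U, φ z ≠ 0) : IsRegularSurface U X := by
  refine ⟨h.contDiffOn hU, fun z hz => ?_⟩
  obtain ⟨hn, ho⟩ := h.isConformalParam hiso z hz
  have hU0 : dU X z ≠ 0 := by
    intro h0
    have h1 : dV X z = 0 := by rw [← norm_eq_zero, ← hn, h0, norm_zero]
    apply hne z hz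
    rw [h.dU_eq hz] at h0
    rw [h.dV_eq hz] at h1
    funext j
    apply Complex.ext
    · simpa using congrArg (fun v : E3 => v j) h0
    · simpa using congrArg (fun v : E3 => v j) h1
  have hV0 : dV X z ≠ 0 := by
    rw [← norm_ne_zero_iff, ← hn]; exact norm_ne_zero_iff.2 hU0
  rw [LinearIndependent.pair_iff]
  intro s t hst
  have h1 := congrArg (fun v => inner ℝ (dU X z) v) hst
  have h2 := congrArg (fun v => inner ℝ (dV X z) v) hst
  have ho' : inner ℝ (dV X z) (dU X z) = 0 := by rw [real_inner_comm]; exact ho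
  simp only [inner_add_right, inner_smul_right, ho, ho', inner_zero_right, mul_zero, add_zero,
    zero_add, mul_eq_zero, inner_self_eq_zero, hU0, hV0, or_false] at h1 h2
  exact ⟨h1, h2⟩

/-- X is harmonic, X_uu = -X_vv, and conformality gives E = G, F = 0. -/
lemma isMinimalSurface (hU : IsOpen U)
    (hiso : ∀ z ∈ U, φ z 0 ^ 2 + φ z 1 ^ 2 + φ z 2 ^ 2 = 0) : IsMinimalSurface U X := by
  intro z hz
  obtain ⟨hn, ho⟩ := h.isConformalParam hiso z hz
  rw [ho, real_inner_self_eq_norm_sq, real_inner_self_eq_norm_sq, hn, h.dV_dV_eq hU hz,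
    h.dU_dU_eq hU hz]
  simp [det3, Matrix.det_fin_three]
  ring

/-- If `φ × φ' = λ φ` with `λ` imaginary, the parameter lines are lines of curvature. -/
lemma isCurvatureLineParam (hU : IsOpen U)
    (hiso : ∀ z ∈ U, φ z 0 ^ 2 + φ z 1 ^ 2 + φ z 2 ^ 2 = 0) (hne : ∀ z ∈ U, φ z ≠ 0) (r : ℝ)
    (hcross : ∀ z ∈ U, φ z 1 * φ' z 2 - φ z 2 * φ' z 1 = Complex.I * r * φ z 0 ∧
      φ z 2 * φ' z 0 - φ z 0 * φ' z 2 = Complex.I * r * φ z 1 ∧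
      φ z 0 * φ' z 1 - φ z 1 * φ' z 0 = Complex.I * r * φ z 2) :
    IsCurvatureLineParam U X := by
  refine ⟨h.isRegularSurface hU hiso hne, fun z hz => (h.isConformalParam hiso z hz).2,
    fun z hz => ?_⟩
  obtain ⟨h0, h1, h2⟩ := hcross z hz
  have i0 := congrArg Complex.im h0
  have i1 := congrArg Complex.im h1
  have i2 := congrArg Complex.im h2
  have him := congrArg Complex.im (hiso z hz)
  rw [h.dV_dU_eq hU hz, h.dU_eq hz, h.dV_eq hz]
  simp [det3, Matrix.det_fin_three, sq] at *
  -- Pairing Im(φ × φ') = r Re φ with Im φ gives minus the determinant on one side, and r Re φ · Im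
  -- φ = 0 on the other by isotropy.
  linear_combination -(φ z 0).im * i0 - (φ z 1).im * i1 - (φ z 2).im * i2 - r / 2 * him

end IsReHolomorphic

/-- The holomorphic form `2 (cn, sn, -i) / dn` whose real part is the differential of the
parametrization. -/
def scherkForm (p : ℝ) (z : ℂ) : Fin 3 → ℂ :=
  ![2 * jacobiCd p z, 2 * jacobiSd p z, -2 * Complex.I * jacobiNd p z]

/-- The derivative of `scherkForm`. -/
def scherkFormDeriv (p q : ℝ) (z : ℂ) : Fin 3 → ℂ :=
  ![-2 * (q ^ 2 * jacobiSd p z * jacobiNd p z), 2 * (jacobiCd p z * jacobiNd p z),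
    -2 * Complex.I * (p ^ 2 * jacobiSd p z * jacobiCd p z)]

namespace IsModulusPair

variable {p q : ℝ} (h : IsModulusPair p q)
include h

/-! ### Differential geometry of branches -/

/-- The logarithmic derivatives pC, ipqS, -iqN, scaled by 2/p, 2/(ipq), 2/q, are the entries of
`scherkForm`. -/
lemma isReHolomorphic {U : Set ℂ} (hU : IsOpen U) (hUD : U ⊆ scherkDomain p) {X : ℂ → E3}
    (hX : IsScherkBranch p q U X) :
    IsReHolomorphic U X (scherkForm p) (scherkFormDeriv p q) := by
  have hp := h.left.1.ne'
  have hq := h.right.1.ne'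
  have hp' : (p : ℂ) ≠ 0 := by exact_mod_cast hp
  have hq' : (q : ℂ) ≠ 0 := by exact_mod_cast hq
  obtain ⟨hc, hv⟩ := (h.isScherkBranch_iff hU hUD).1 hX
  refine ⟨fun z hz j => ?_, fun z hz j => ?_⟩
  all_goals have hz' := h.mem_scherkDomain.1 (hUD hz)
  · have hev : ∀ᶠ w in nhds z, w ∈ U := hU.mem_nhds hz
    have hXj (j : Fin 3) : ContinuousAt (fun w => X w j) z :=
      (EuclideanSpace.proj (𝕜 := ℝ) j).continuous.continuousAt.comp
        (hc.continuousAt (hU.mem_nhds hz))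
    fin_cases j
    · have := hasFDerivAt_of_exp_eq_norm_sq (x := fun w => X w 0) hp (h.scherkExp₁_ne_zero hz')
        (h.hasDerivAt_scherkExp₁ hz') (hev.mono fun w hw => (hv w hw).fst)
      convert! this using 3
      simp [scherkForm]
      field_simp
    · have := hasFDerivAt_of_exp_mul_I_mul_norm_sq (x := fun w => X w 1) (mul_ne_zero hp hq)
        (h.scherkExp₂_ne_zero hz') (h.hasDerivAt_scherkExp₂ hz') (hXj 1)
        (hev.mono fun w hw => (hv w hw).snd)
      convert! this using 3
      simp [scherkForm]
      field_simp
    · have := hasFDerivAt_of_exp_eq_norm_sq (x := fun w => X w 2) hq (h.scherkExp₃_ne_zero hz')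
        (h.hasDerivAt_scherkExp₃ hz') (hev.mono fun w hw => (hv w hw).trd)
      convert! this using 3
      simp [scherkForm]
      field_simp
  · fin_cases j
    · refine ((h.hasDerivAt_jacobiCd hz').const_mul 2).congr_deriv ?_
      simp [scherkFormDeriv]
    · exact (h.hasDerivAt_jacobiSd hz').const_mul 2
    · exact (h.hasDerivAt_jacobiNd hz').const_mul (-2 * Complex.I)

lemma scherkForm_isotropic {z : ℂ} (hz : jacobiDen' p z ≠ 0) :
    scherkForm p z 0 ^ 2 + scherkForm p z 1 ^ 2 + scherkForm p z 2 ^ 2 = 0 := by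
  simp only [scherkForm, Matrix.cons_val]
  linear_combination 4 * h.jacobiCd_sq hz - 4 * h.jacobiNd_sq hz -
    4 * jacobiSd p z ^ 2 * h.ofReal_sq_add_sq + 4 * jacobiNd p z ^ 2 * Complex.I_sq

lemma scherkForm_ne_zero {z : ℂ} (hz : jacobiDen' p z ≠ 0) : scherkForm p z ≠ 0 := by
  intro h0
  have h1 : jacobiCd p z = 0 := by simpa [scherkForm] using congrFun h0 0
  have h2 : jacobiSd p z = 0 := by simpa [scherkForm] using congrFun h0 1
  have := h.jacobiCd_sq hz
  simp [h1, h2] at this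

lemma isCurvatureLineParam {U : Set ℂ} (hU : IsOpen U) (hUD : U ⊆ scherkDomain p) {X : ℂ → E3}
    (hX : IsScherkBranch p q U X) : IsCurvatureLineParam U X := by
  refine (h.isReHolomorphic hU hUD hX).isCurvatureLineParam hU
    (fun z hz => h.scherkForm_isotropic (h.mem_scherkDomain.1 (hUD hz)))
    (fun z hz => h.scherkForm_ne_zero (h.mem_scherkDomain.1 (hUD hz))) 2 fun z hz => ?_
  have hz' := h.mem_scherkDomain.1 (hUD hz)
  have hN := h.jacobiNd_sq hz'
  have hC := h.jacobiCd_sq hz'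
  simp only [scherkForm, scherkFormDeriv, Matrix.cons_val, Complex.ofReal_ofNat]
  refine ⟨?_, ?_, ?_⟩
  · linear_combination 4 * Complex.I * jacobiCd p z * hN
  · linear_combination 4 * Complex.I * jacobiSd p z * (q ^ 2 * hN + p ^ 2 * hC +
      h.ofReal_sq_add_sq)
  · linear_combination 4 * jacobiNd p z * hC + 4 * jacobiNd p z * Complex.I_sq

/-- `cn² + sn² = 1`, where `dn` does not vanish. -/
lemma jacobiSn_sq_add_jacobiCn_sq {z : ℂ} (hz : jacobiDen p z ≠ 0) (hz' : jacobiDen' p z ≠ 0) :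
    jacobiSn p z ^ 2 + jacobiCn p z ^ 2 = 1 := by
  have hN := h.jacobiNd_mul_jacobiDn hz hz'
  rw [h.jacobiSn_eq hz hz', h.jacobiCn_eq hz hz']
  linear_combination jacobiDn p z ^ 2 * (h.jacobiCd_sq hz' - h.jacobiNd_sq hz' -
    jacobiSd p z ^ 2 * h.ofReal_sq_add_sq) + (jacobiNd p z * jacobiDn p z + 1) * hN

/-- Put e = cn + i sn, which is invertible since e(cn - i sn) = 1. Then y = -ie and y' = dn · e,
while 1 - y² = 2 cn · e and i(1 + y²) = 2 sn · e. The Weierstrass form is thus 2(C, S, iN), which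
differs from `scherkForm` by the sign of the third entry; hence the reflection. -/
lemma isWeierstrassRep {U : Set ℂ} (hU : IsOpen U) (hUD : U ⊆ scherkDomain p) {X : ℂ → E3}
    (hX : IsScherkBranch p q U X) :
    IsWeierstrassRep (fun z => jacobiSn p z - Complex.I * jacobiCn p z) (fun _ => 1)
      (U \ jacobiPoles p) (fun z => reflect3 (X z)) := by
  have hy {z : ℂ} (hz : jacobiDen p z ≠ 0) :
      HasDerivAt (fun z => jacobiSn p z - Complex.I * jacobiCn p z)
        (jacobiDn p z * (jacobiCn p z + Complex.I * jacobiSn p z)) z := by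
    refine ((h.hasDerivAt_jacobiSn hz).sub
      ((h.hasDerivAt_jacobiCn hz).const_mul Complex.I)).congr_deriv ?_
    ring
  have hne {z : ℂ} (hz : jacobiDen p z ≠ 0) (hz' : jacobiDen' p z ≠ 0) :
      jacobiDn p z * (jacobiCn p z + Complex.I * jacobiSn p z) ≠ 0 := by
    refine mul_ne_zero (h.jacobiDn_ne_zero hz hz')
      (left_ne_zero_of_mul_eq_one (b := jacobiCn p z - Complex.I * jacobiSn p z) ?_)
    linear_combination h.jacobiSn_sq_add_jacobiCn_sq hz hz' - jacobiSn p z ^ 2 * Complex.I_sq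
  refine ⟨fun z ⟨hzU, hz⟩ => ⟨(hy hz).differentiableAt, ?_⟩, fun z ⟨hzU, hz⟩ j => ?_⟩
  · rw [(hy hz).deriv]
    exact hne hz (h.mem_scherkDomain.1 (hUD hzU))
  · have hz' := h.mem_scherkDomain.1 (hUD hzU)
    have hd := h.jacobiDn_ne_zero hz hz'
    have hn := hne hz hz'
    have hN := h.jacobiNd_mul_jacobiDn hz hz'
    have hS := h.jacobiSn_eq hz hz'
    have hC := h.jacobiCn_eq hz hz'
    have h1 := h.jacobiSn_sq_add_jacobiCn_sq hz hz'
    have hX := (h.isReHolomorphic hU hUD hX).diff z hzU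
    fin_cases j
    · refine (hX 0).congr_fderiv ?_
      congr 2
      simp only [scherkForm, weierstrassForm, (hy hz).deriv, Fin.zero_eta, Matrix.cons_val]
      rw [mul_one_div, eq_div_iff hn]
      linear_combination -2 * (jacobiCn p z + Complex.I * jacobiSn p z) * hC + h1 +
        jacobiCn p z ^ 2 * Complex.I_sq
    · refine (hX 1).congr_fderiv ?_
      congr 2
      simp only [scherkForm, weierstrassForm, (hy hz).deriv, Fin.mk_one, Matrix.cons_val]
      rw [mul_one_div, eq_div_iff hn]
      linear_combination -2 * (jacobiCn p z + Complex.I * jacobiSn p z) * hS + Complex.I * h1 +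
        (2 * jacobiSn p z * jacobiCn p z - Complex.I * jacobiCn p z ^ 2) * Complex.I_sq
    · refine (hX 2).neg.congr_fderiv ?_
      rw [← ContinuousLinearMap.comp_neg, ← map_neg]
      congr 2
      simp only [scherkForm, weierstrassForm, (hy hz).deriv, Fin.reduceFinMk, Matrix.cons_val]
      rw [mul_one_div, eq_div_iff hn]
      linear_combination 2 * Complex.I * (jacobiCn p z + Complex.I * jacobiSn p z) * hN +
        2 * jacobiSn p z * Complex.I_sq

/-! ### The values lie on the tower -/

/-- Averaging |E|² and |1/E|² gives cosh(p x₁) = |N|² + p²|S|² and cosh(q x₃) = |C|² + q²|S|². The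
unit number exp(i p q x₂) is E₂ times the conjugate of 1/E₂, with real part p²|C|² - q²|N|². In the
equation of the tower everything cancels. -/
lemma _root_.IsScherkValue.mem_scherkTower {z : ℂ} {x : E3} (hx : IsScherkValue p q z x)
    (hz : jacobiDen' p z ≠ 0) : x ∈ scherkTower p q := by
  have hE1 := h.scherkExp₁_mul hz
  have hE2 := h.scherkExp₂_mul hz
  have hE3 := h.scherkExp₃_mul hz
  have hcosh {t : ℝ} {E F : ℂ} (ht : Real.exp t = ‖E‖ ^ 2) (hEF : E * F = 1) :
      Real.cosh t = (Complex.normSq E + Complex.normSq F) / 2 := by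
    have h1 : Real.exp t * Real.exp (-t) = 1 := by rw [← Real.exp_add]; simp
    have h2 : Complex.normSq E * Complex.normSq F = 1 := by
      rw [← Complex.normSq_mul, hEF, Complex.normSq_one]
    rw [← Complex.normSq_eq_norm_sq] at ht
    have h3 : Real.exp (-t) = Complex.normSq F := by
      apply mul_left_cancel₀ (Real.exp_ne_zero t)
      rw [h1, ht, h2]
    rw [Real.cosh_eq, ht, h3]
  have c1 := hcosh hx.fst hE1
  have c3 := hcosh hx.trd hE3
  have c2 : Real.cos (p * q * x 1) =
      p ^ 2 * Complex.normSq (jacobiCd p z) - q ^ 2 * Complex.normSq (jacobiNd p z) := by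
    have hn : (‖scherkExp₂ p q z‖ : ℂ) ^ 2 =
        scherkExp₂ p q z * (starRingEnd ℂ) (scherkExp₂ p q z) := by
      rw [Complex.mul_conj, Complex.normSq_eq_norm_sq]; push_cast; rfl
    have h2 := hx.snd
    rw [hn] at h2
    have hc := congrArg (starRingEnd ℂ) hE2
    rw [map_mul, map_one] at hc
    have h3 : Complex.exp ((p * q * x 1 : ℝ) * Complex.I) = scherkExp₂ p q z *
        (starRingEnd ℂ) (p * jacobiCd p z - Complex.I * q * jacobiNd p z) := by
      apply mul_left_cancel₀ (h.scherkExp₂_ne_zero hz)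
      linear_combination (starRingEnd ℂ) (p * jacobiCd p z - Complex.I * q * jacobiNd p z) * h2 -
        scherkExp₂ p q z * Complex.exp ((p * q * x 1 : ℝ) * Complex.I) * hc
    have h4 := congrArg Complex.re h3
    rw [Complex.exp_ofReal_mul_I_re] at h4
    rw [h4]
    simp [scherkExp₂, Complex.normSq_apply]
    ring
  change _ = (0 : ℝ)
  rw [c1, c2, c3]
  simp [scherkExp₁, scherkExp₃, Complex.normSq_apply]
  ring

/-! ### Uniformization of the curve `C² = 1 - q² S²`, `N² = 1 + p² S²` -/

/-- `dn² + p² sn² = 1`, also where `dn` vanishes. -/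
lemma jacobiDn_sq_add {z : ℂ} (hz : jacobiDen p z ≠ 0) :
    jacobiDn p z ^ 2 + (p : ℂ) ^ 2 * jacobiSn p z ^ 2 = 1 := by
  simp only [jacobiDn, jacobiSn, jacobiDen, h.compMod_eq] at *
  have e₁ := realSn_sq_add_realCn_sq p z.re
  have e₂ := realSn_sq_add_realCn_sq q z.im
  have e₃ := realDn_sq h.left z.re
  have e₄ := realDn_sq h.right z.im
  have e₅ := h.sq_add_sq
  generalize realSn p z.re = s at *
  generalize realCn p z.re = c at *
  generalize realDn p z.re = d at *
  generalize realSn q z.im = s₁ at *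
  generalize realCn q z.im = c₁ at *
  generalize realDn q z.im = d₁ at *
  have hz' : ((c₁ ^ 2 + p ^ 2 * s ^ 2 * s₁ ^ 2 : ℝ) : ℂ) ≠ 0 := by exact_mod_cast hz
  rw [div_pow, div_pow, ← mul_div_assoc, ← add_div, div_eq_one_iff_eq (pow_ne_zero 2 hz')]
  simp only [pow_two]
  apply Complex.ext
  · simp [-Complex.ofReal_mul, -Complex.ofReal_pow, -Complex.ofReal_add, -Complex.ofReal_sub]
    grind
  · simp [-Complex.ofReal_mul, -Complex.ofReal_pow, -Complex.ofReal_add, -Complex.ofReal_sub]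
    grind

/-- A compact set that contains a representative of every point modulo periods. -/
def _root_.periodBox (p q : ℝ) : Set ℂ :=
  Set.Icc 0 (ellipticF p (2 * Real.pi)) ×ℂ Set.Icc 0 (ellipticF q (2 * Real.pi))

lemma exists_mem_periodBox (θ θ₁ : ℝ) : ∃ z ∈ periodBox p q,
    realSn p z.re = Real.sin θ ∧ realCn p z.re = Real.cos θ ∧
    realSn q z.im = Real.sin θ₁ ∧ realCn q z.im = Real.cos θ₁ := by
  obtain ⟨u, hu, h1, h2⟩ := exists_mem_Icc_realAm_trig_eq h.left θ
  obtain ⟨v, hv, h3, h4⟩ := exists_mem_Icc_realAm_trig_eq h.right θ₁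
  exact ⟨⟨u, v⟩, ⟨hu, hv⟩, h1, h2, h3, h4⟩

lemma exists_mem_periodBox_jacobiSd_eq (z : ℂ) : ∃ w ∈ periodBox p q,
    jacobiDen' p w = jacobiDen' p z ∧ jacobiSd p w = jacobiSd p z := by
  obtain ⟨w, hw, h1, h2, h3, h4⟩ := h.exists_mem_periodBox (realAm p z.re) (realAm q z.im)
  change _ = realSn p z.re at h1
  change _ = realCn p z.re at h2
  change _ = realSn q z.im at h3
  change _ = realCn q z.im at h4
  refine ⟨w, hw, ?_, ?_⟩ <;>
  simp only [jacobiDen', jacobiSd, realDn, h.compMod_eq, h1, h2, h3, h4]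

/-- Modulo periods this is z ↦ 2K - z, where K is the quarter period: the amplitudes become π - α
and -β, which flips the signs of c and s₁ only. -/
lemma exists_neg_jacobiCd (z : ℂ) : ∃ w, jacobiDen' p w = jacobiDen' p z ∧
    jacobiCd p w = -jacobiCd p z ∧ jacobiSd p w = jacobiSd p z ∧ jacobiNd p w = jacobiNd p z := by
  obtain ⟨w, -, h1, h2, h3, h4⟩ :=
    h.exists_mem_periodBox (Real.pi - realAm p z.re) (-realAm q z.im)
  rw [Real.sin_pi_sub] at h1
  rw [Real.cos_pi_sub] at h2
  rw [Real.sin_neg] at h3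
  rw [Real.cos_neg] at h4
  change _ = realSn p z.re at h1
  change _ = -realCn p z.re at h2
  change _ = -realSn q z.im at h3
  change _ = realCn q z.im at h4
  refine ⟨w, ?_, ?_, ?_, ?_⟩ <;>
  simp only [jacobiDen', jacobiCd, jacobiSd, jacobiNd, realDn, h.compMod_eq, h1, h2, h3, h4] <;>
  push_cast <;> ring_nf

/-- The analogous symmetry z ↦ 2iK' - z, flipping the signs of s and c₁ only. -/
lemma exists_neg_jacobiNd (z : ℂ) : ∃ w, jacobiDen' p w = jacobiDen' p z ∧
    jacobiCd p w = jacobiCd p z ∧ jacobiSd p w = jacobiSd p z ∧ jacobiNd p w = -jacobiNd p z := by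
  obtain ⟨w, -, h1, h2, h3, h4⟩ :=
    h.exists_mem_periodBox (-realAm p z.re) (Real.pi - realAm q z.im)
  rw [Real.sin_neg] at h1
  rw [Real.cos_neg] at h2
  rw [Real.sin_pi_sub] at h3
  rw [Real.cos_pi_sub] at h4
  change _ = -realSn p z.re at h1
  change _ = realCn p z.re at h2
  change _ = realSn q z.im at h3
  change _ = -realCn q z.im at h4
  refine ⟨w, ?_, ?_, ?_, ?_⟩ <;>
  simp only [jacobiDen', jacobiCd, jacobiSd, jacobiNd, realDn, h.compMod_eq, h1, h2, h3, h4] <;>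
  push_cast <;> ring_nf

/-- If S were locally constant, S' = CN would vanish near z, and so would (CN)' at z. Together with
either C = 0 or N = 0 this forces S = 0, against C² = 1 - q²S² or N² = 1 + p²S². -/
lemma not_eventually_jacobiSd_eq {z : ℂ} (hz : jacobiDen' p z ≠ 0) :
    ¬ ∀ᶠ w in nhds z, jacobiSd p w = jacobiSd p z := by
  intro hS
  have hSz : ∀ᶠ w in nhds z, jacobiCd p w * jacobiNd p w = 0 := by
    filter_upwards [hS.eventually_nhds, h.eventually_jacobiDen'_ne_zero hz] with w hw hw'
    rw [← (h.hasDerivAt_jacobiSd hw').deriv, (Filter.EventuallyEq.deriv_eq (f := fun _ => _) hw)]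
    simp
  have hder := ((h.hasDerivAt_jacobiCd hz).mul (h.hasDerivAt_jacobiNd hz)).deriv
  have h0 : deriv (jacobiCd p * jacobiNd p) z = 0 := by
    have : jacobiCd p * jacobiNd p =ᶠ[nhds z] fun _ => 0 := hSz
    rw [this.deriv_eq, deriv_const]
  rw [h0] at hder
  have hCN := hSz.self_of_nhds
  have hC := h.jacobiCd_sq hz
  have hN := h.jacobiNd_sq hz
  have hpq := h.ofReal_sq_add_sq
  rcases mul_eq_zero.1 hCN with h1 | h1
  · rw [h1] at hC hder
    have e : (q : ℂ) ^ 2 * jacobiNd p z ^ 2 = 1 := by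
      linear_combination q ^ 2 * hN + p ^ 2 * hC + hpq
    have e2 : (q : ℂ) ^ 2 * jacobiSd p z * jacobiNd p z ^ 2 = 0 := by
      linear_combination hder
    have e3 : jacobiSd p z = 0 := by linear_combination e2 - jacobiSd p z * e
    simp [e3] at hC
  · rw [h1] at hN hder
    have e : (p : ℂ) ^ 2 * jacobiCd p z ^ 2 = 1 := by
      linear_combination p ^ 2 * hC + q ^ 2 * hN + hpq
    have e2 : (p : ℂ) ^ 2 * jacobiSd p z * jacobiCd p z ^ 2 = 0 := by
      linear_combination -hder
    have e3 : jacobiSd p z = 0 := by linear_combination e2 - jacobiSd p z * e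
    simp [e3] at hN

lemma isOpen_image_jacobiSd : IsOpen (jacobiSd p '' scherkDomain p) := by
  rw [isOpen_iff_mem_nhds]
  rintro _ ⟨z, hz, rfl⟩
  have hz' := h.mem_scherkDomain.1 hz
  exact ((h.analyticAt_jacobiSd hz').eventually_constant_or_nhds_le_map_nhds.resolve_left
    (h.not_eventually_jacobiSd_eq hz')) (Filter.image_mem_map (h.isOpen_scherkDomain.mem_nhds hz))

/-- Preimages of a convergent sequence may be taken in the compact period box, so a subsequence of
them converges. If its limit were a zero of dn, then sn = sd · dn would tend to 0 because sd stays
bounded, contradicting dn² + p² sn² = 1. -/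
lemma isClosed_image_jacobiSd : IsClosed (jacobiSd p '' scherkDomain p) := by
  refine IsSeqClosed.isClosed fun y w hy hw => ?_
  have hex (n : ℕ) : ∃ z ∈ periodBox p q, jacobiDen' p z ≠ 0 ∧ jacobiSd p z = y n := by
    obtain ⟨z, hz, hzy⟩ := hy n
    obtain ⟨z', hz', h1, h2⟩ := h.exists_mem_periodBox_jacobiSd_eq z
    exact ⟨z', hz', h1 ▸ h.mem_scherkDomain.1 hz, h2.trans hzy⟩
  choose z hzK hz hzy using hex
  have hK : IsCompact (periodBox p q) := isCompact_Icc.reProdIm isCompact_Icc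
  obtain ⟨z₀, -, φ, hφ, hlim⟩ := hK.tendsto_subseq hzK
  have hy' := hw.comp hφ.tendsto_atTop
  by_cases hz₀ : jacobiDen' p z₀ = 0
  · exfalso
    have hD : jacobiDen p z₀ ≠ 0 := fun h0 =>
      h.jacobiDen'_ne_zero_of_jacobiDen_eq_zero h0 hz₀
    have hdn : jacobiDn p z₀ = 0 := by
      have := h.normSq_jacobiDn hD
      rw [hz₀] at this
      simpa [hD] using this
    have h1 := (h.hasDerivAt_jacobiDn hD).continuousAt.tendsto.comp hlim
    have h2 := (h.hasDerivAt_jacobiSn hD).continuousAt.tendsto.comp hlim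
    have h3 := hy'.mul h1
    rw [hdn, mul_zero] at h3
    have hev := hlim.eventually (h.continuous_jacobiDen.continuousAt.eventually_ne hD)
    have hsn : jacobiSn p z₀ = 0 := by
      refine tendsto_nhds_unique_of_eventuallyEq h2 h3 ?_
      filter_upwards [hev] with n hn
      simp only [Function.comp_apply, ← hzy]
      exact h.jacobiSn_eq hn (hz _)
    have := h.jacobiDn_sq_add hD
    simp [hdn, hsn] at this
  · refine ⟨z₀, h.mem_scherkDomain.2 hz₀, ?_⟩
    refine tendsto_nhds_unique
      ((h.hasDerivAt_jacobiSd hz₀).continuousAt.tendsto.comp hlim) (hy'.congr fun n => ?_)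
    simp [hzy]

lemma exists_jacobiSd_eq (w : ℂ) : ∃ z, jacobiDen' p z ≠ 0 ∧ jacobiSd p z = w := by
  have hne : (jacobiSd p '' scherkDomain p).Nonempty := by
    obtain ⟨z, -, h1, h2, h3, h4⟩ := h.exists_mem_periodBox 0 0
    refine ⟨_, z, h.mem_scherkDomain.2 ?_, rfl⟩
    simp [jacobiDen', realDn, h.compMod_eq, h1, h3]
  have := IsClopen.eq_univ ⟨h.isClosed_image_jacobiSd, h.isOpen_image_jacobiSd⟩ hne
  obtain ⟨z, hz, hzw⟩ := this ▸ Set.mem_univ w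
  exact ⟨z, h.mem_scherkDomain.1 hz, hzw⟩

/-- The functions `cd`, `sd`, `nd` uniformize the elliptic curve that they satisfy. -/
theorem exists_jacobi_eq {C S N : ℂ} (hC : C ^ 2 = 1 - (q : ℂ) ^ 2 * S ^ 2)
    (hN : N ^ 2 = 1 + (p : ℂ) ^ 2 * S ^ 2) :
    ∃ z, jacobiDen' p z ≠ 0 ∧ jacobiCd p z = C ∧ jacobiSd p z = S ∧ jacobiNd p z = N := by
  obtain ⟨z, hz, hS⟩ := h.exists_jacobiSd_eq S
  obtain ⟨z', hz', hC', hS', hN'⟩ : ∃ z, jacobiDen' p z ≠ 0 ∧ jacobiCd p z = C ∧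
      jacobiSd p z = S ∧ jacobiNd p z ^ 2 = N ^ 2 := by
    have h1 : jacobiCd p z ^ 2 = C ^ 2 := by rw [h.jacobiCd_sq hz, hC, hS]
    have h2 : jacobiNd p z ^ 2 = N ^ 2 := by rw [h.jacobiNd_sq hz, hN, hS]
    rcases sq_eq_sq_iff_eq_or_eq_neg.1 h1 with h3 | h3
    · exact ⟨z, hz, h3, hS, h2⟩
    · obtain ⟨w, w1, w2, w3, w4⟩ := h.exists_neg_jacobiCd z
      exact ⟨w, w1 ▸ hz, by rw [w2, h3, neg_neg], w3.trans hS, by rw [w4, h2]⟩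
  rcases sq_eq_sq_iff_eq_or_eq_neg.1 hN' with h3 | h3
  · exact ⟨z', hz', hC', hS', h3⟩
  · obtain ⟨w, w1, w2, w3, w4⟩ := h.exists_neg_jacobiNd z'
    exact ⟨w, w1 ▸ hz', w2.trans hC', w3.trans hS', by rw [w4, h3, neg_neg]⟩

/-! ### Every point of the tower is attained -/

/-- With p x₁ = 2a, p q x₂ = 2b and q x₃ = 2g, one needs |E₁| = e^a, |E₃| = e^g and E₂ a real
multiple of e^{ib}. The explicit C, S, N below achieve this through the factorizations `E1`, `E2`,
`E3`. -/
theorem exists_isScherkValue_of_mem_scherkTower {x : E3} (hx : x ∈ scherkTower p q) :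
    ∃ z, jacobiDen' p z ≠ 0 ∧ IsScherkValue p q z x := by
  have hp := h.left.1.ne'
  have hq := h.right.1.ne'
  have hpC : (p : ℂ) ≠ 0 := by exact_mod_cast hp
  have hqC : (q : ℂ) ≠ 0 := by exact_mod_cast hq
  have hpq := h.sq_add_sq
  obtain ⟨a, ha⟩ : ∃ a, p * x 0 = 2 * a := ⟨p * x 0 / 2, by ring⟩
  obtain ⟨b, hb⟩ : ∃ b, p * q * x 1 = 2 * b := ⟨p * q * x 1 / 2, by ring⟩
  obtain ⟨g, hg⟩ : ∃ g, q * x 2 = 2 * g := ⟨q * x 2 / 2, by ring⟩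
  have hea : Real.exp (2 * a) = (Real.cosh a + Real.sinh a) ^ 2 := by
    rw [Real.cosh_add_sinh, ← Real.exp_nat_mul]; norm_num
  have heg : Real.exp (2 * g) = (Real.cosh g + Real.sinh g) ^ 2 := by
    rw [Real.cosh_add_sinh, ← Real.exp_nat_mul]; norm_num
  have heb : Complex.exp ((2 * b : ℝ) * Complex.I) =
      (Real.cos b + Complex.I * Real.sin b) ^ 2 := by
    rw [mul_comm Complex.I, Complex.ofReal_cos, Complex.ofReal_sin, ← Complex.exp_mul_I,
      ← Complex.exp_nat_mul]
    congr 1; push_cast; ring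
  have hnb : ‖(Real.cos b + Complex.I * Real.sin b : ℂ)‖ = 1 := by
    rw [mul_comm Complex.I, Complex.ofReal_cos, Complex.ofReal_sin, ← Complex.exp_mul_I,
      Complex.norm_exp_ofReal_mul_I]
  have hx' : q ^ 2 * Real.cosh (p * x 0) + Real.cos (p * q * x 1) -
    p ^ 2 * Real.cosh (q * x 2) = 0 := hx
  rw [ha, hb, hg, Real.cosh_two_mul, Real.cosh_two_mul, Real.cos_two_mul] at hx'
  have e1 := Real.cosh_sq a
  have e2 := Real.cosh_sq g
  have e3 := Real.sin_sq_add_cos_sq b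
  have hRpos : 0 < Real.cosh a ^ 2 + Real.sinh g ^ 2 := by
    have := Real.cosh_pos a
    positivity
  -- R is the common normalization of C, S and N.
  obtain ⟨R, hR, hR2⟩ : ∃ R : ℝ, R ≠ 0 ∧ R ^ 2 = Real.cosh a ^ 2 + Real.sinh g ^ 2 :=
    ⟨_, (Real.sqrt_pos.2 hRpos).ne', Real.sq_sqrt hRpos.le⟩
  have hRC : (R : ℂ) ≠ 0 := by exact_mod_cast hR
  generalize Real.cosh a = ca at *
  generalize Real.sinh a = sa at *
  generalize Real.cosh g = cg at *
  generalize Real.sinh g = sg at *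
  generalize Real.cos b = cb at *
  generalize Real.sin b = sb at *
  -- Given the definition of R, these are two forms of the equation of the tower. They say that the
  -- complex factors in `E1` and `E3` have moduli q|R| and p|R|.
  have k1 : q ^ 2 * R ^ 2 = sb ^ 2 + sg ^ 2 := by grind
  have k2 : p ^ 2 * R ^ 2 = ca ^ 2 - sb ^ 2 := by grind
  have hC : ((ca * cg * cb - Complex.I * (sa * sg * sb)) / (p * R) : ℂ) ^ 2 =
      1 - (q : ℂ) ^ 2 * ((sa * cg * sb + Complex.I * (ca * sg * cb)) / (p * q * R)) ^ 2 := by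
    field_simp
    apply Complex.ext
    · simp [sq]
      grind
    · simp [sq]
      ring
  have hN : ((ca * cg * sb + Complex.I * (sa * sg * cb)) / (q * R) : ℂ) ^ 2 =
      1 + (p : ℂ) ^ 2 * ((sa * cg * sb + Complex.I * (ca * sg * cb)) / (p * q * R)) ^ 2 := by
    field_simp
    apply Complex.ext
    · simp [sq]
      grind
    · simp [sq]
      ring
  obtain ⟨z, hz, zC, zS, zN⟩ := h.exists_jacobi_eq hC hN
  have E1 : scherkExp₁ p z = ((ca + sa) / (q * R) : ℝ) * (cg * sb + Complex.I * (sg * cb)) := by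
    rw [scherkExp₁, zS, zN]; push_cast; field_simp; ring
  have E2 : scherkExp₂ p q z = ((ca * cg - sa * sg) / R : ℝ) * (cb + Complex.I * sb) := by
    rw [scherkExp₂, zC, zN]; push_cast; field_simp
    linear_combination sa * sg * cb * Complex.I_sq
  have E3 : scherkExp₃ p q z = ((cg + sg) / (p * R) : ℝ) * (ca * cb - Complex.I * (sa * sb)) := by
    rw [scherkExp₃, zC, zS]; push_cast; field_simp
    linear_combination -ca * sg * cb * Complex.I_sq
  refine ⟨z, hz, ?_, ?_, ?_⟩
  · rw [ha, hea, E1, norm_mul, mul_pow, ← Complex.normSq_eq_norm_sq, ← Complex.normSq_eq_norm_sq,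
      Complex.normSq_ofReal]
    have : Complex.normSq (cg * sb + Complex.I * (sg * cb)) = q ^ 2 * R ^ 2 := by
      simp [Complex.normSq_apply]
      grind
    rw [this]
    field_simp
  · rw [hb, heb, E2, norm_mul, hnb, mul_one, Complex.norm_real, ← Complex.ofReal_pow,
      Real.norm_eq_abs, sq_abs]
    push_cast
    ring
  · rw [hg, heg, E3, norm_mul, mul_pow, ← Complex.normSq_eq_norm_sq, ← Complex.normSq_eq_norm_sq,
      Complex.normSq_ofReal]
    have : Complex.normSq (ca * cb - Complex.I * (sa * sb)) = p ^ 2 * R ^ 2 := by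
      simp [Complex.normSq_apply]
      grind
    rw [this]
    field_simp

theorem exists_isScherkBranch_of_mem_scherkTower {x : E3} (hx : x ∈ scherkTower p q) :
    ∃ U : Set ℂ, IsOpen U ∧ U ⊆ scherkDomain p ∧
      ∃ X : ℂ → E3, IsScherkBranch p q U X ∧ ∃ z ∈ U, X z = x := by
  obtain ⟨z, hz, hzx⟩ := h.exists_isScherkValue_of_mem_scherkTower hx
  obtain ⟨ε, hε, hball⟩ :=
    Metric.isOpen_iff.1 h.isOpen_scherkDomain z (h.mem_scherkDomain.2 hz)
  have hzb := Metric.mem_ball_self (x := z) hε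
  have hs : IsSimplyConnected (Metric.ball z ε) := by
    have := (convex_ball z ε).contractibleSpace ⟨z, hzb⟩
    change SimplyConnectedSpace _
    infer_instance
  obtain ⟨X, hX, hXz⟩ := h.exists_isScherkBranch_apply_eq Metric.isOpen_ball hball hs hzb hzx
  exact ⟨_, Metric.isOpen_ball, hball, X, hX, z, hzb, hXz⟩

end IsModulusPair
end

/-! ### Assembly of the main theorem. -/

theorem lemma3p1 (p q : ℝ) (hp : p ∈ Set.Ioo (0 : ℝ) 1) (hq : q ∈ Set.Ioo (0 : ℝ) 1)
    (hpq : p ^ 2 + q ^ 2 = 1) :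
    -- the functions in the formula are the Jacobi elliptic functions with modulus `p`
    IsJacobiTriple p (jacobiPoles p) (jacobiSn p) (jacobiCn p) (jacobiDn p) ∧
    -- the multivalued formula has a branch on every simply connected open part of the domain
    (∀ U : Set ℂ, IsOpen U → U ⊆ scherkDomain p → IsSimplyConnected U →
      ∃ X : ℂ → E3, IsScherkBranch p q U X) ∧
    -- every branch is a conformal curvature line parametrization of a minimal surface
    -- on the tower, given up to a reflection by the Weierstrass representation
    (∀ U : Set ℂ, IsOpen U → U ⊆ scherkDomain p → ∀ X : ℂ → E3, IsScherkBranch p q U X →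
      IsCurvatureLineParam U X ∧ IsConformalParam U X ∧ IsMinimalSurface U X ∧
      IsWeierstrassRep (fun z => jacobiSn p z - Complex.I * jacobiCn p z) (fun _ => 1)
        (U \ jacobiPoles p) (fun z => reflect3 (X z)) ∧
      ∀ z ∈ U, X z ∈ scherkTower p q) ∧
    -- the whole tower is parametrized
    (∀ x ∈ scherkTower p q, ∃ U : Set ℂ, IsOpen U ∧ U ⊆ scherkDomain p ∧
      ∃ X : ℂ → E3, IsScherkBranch p q U X ∧ ∃ z ∈ U, X z = x) := by
  have h : IsModulusPair p q := ⟨hp, hq, hpq⟩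
  refine ⟨h.isJacobiTriple, fun U hU hUD hUs => h.exists_isScherkBranch hU hUD hUs,
    fun U hU hUD X hX => ?_, fun x hx => h.exists_isScherkBranch_of_mem_scherkTower hx⟩
  have hφ := h.isReHolomorphic hU hUD hX
  have hiso : ∀ z ∈ U, scherkForm p z 0 ^ 2 + scherkForm p z 1 ^ 2 + scherkForm p z 2 ^ 2 = 0 :=
    fun z hz => h.scherkForm_isotropic (h.mem_scherkDomain.1 (hUD hz))
  exact ⟨h.isCurvatureLineParam hU hUD hX, hφ.isConformalParam hiso, hφ.isMinimalSurface hU hiso,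
    h.isWeierstrassRep hU hUD hX, fun z hz =>
      (((h.isScherkBranch_iff hU hUD).1 hX).2 z hz).mem_scherkTower h
        (h.mem_scherkDomain.1 (hUD hz))⟩
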